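/- Let $k\ge 1$, $n=2k$, $\mu>0$ and $\psi\in(0,\pi/2)$. For functions $f$ on $\mathbb{R}^{n}\times\mathbb{R}$ (complex-valued) define the attenuated conical Radon transform and its auxiliary transform by $$C_\mu f(\mathbf u,v)=\frac{\tan^{n-1}\psi}{\cos\psi}\int_{S^{n-1}}\int_0^\infty f\big((\mathbf u,v)+(z\tan\psi\,\boldsymbol\omega,z)\big)\,e^{-\frac{\mu}{\cos\psi}z}z^{n-1}\,dz\,dS(\boldsymbol\omega),$$ $$A_\mu f(\mathbf u,v)=\frac{\tan^{n-1}\psi}{\cos\psi}\int_{S^{n-1}}\int_0^\infty f\big((\mathbf u,v)+(z\tan\psi\,\boldsymbol\omega,z)\big)\,e^{-\frac{\mu}{\cos\psi}z}z^{n-2}\,dz\,dS(\boldsymbol\omega),$$ and let $$L=\frac{\mu^2}{\cos^2\psi}-\frac{2\mu}{\cos\psi}\partial_z+\partial_z^2-\tan^2\psi\,\Delta_{\mathbf x}.$$ Call $g$ tempered if $(1+|p|)^{-N}g(p)$ is integrable on $\mathbb{R}^{n}\times\mathbb{R}$ for some $N\in\mathbb{N}$ (for instance, $g$ bounded or of polynomial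 growth). Let $g\in C^\infty(\mathbb{R}^{2k}\times\mathbb{R})$. If $g$ is in the range of $C_\mu$ on $C_c^\infty(\mathbb{R}^{2k}\times\mathbb{R})$, then $g$ is tempered. If $g$ is tempered, then $g$ is in the range of $C_\mu$ on $C_c^\infty(\mathbb{R}^{2k}\times\mathbb{R})$ if and only if $A_\mu g$ is well defined and smooth (its integral converges absolutely at every point and $A_\mu g\in C^\infty$), and (i) $L^{2k}A_\mu g(\mathbf x,z)$ has compact support; (ii) $\displaystyle\int_{-\infty}^{\infty}e^{-\frac{\mu}{\cos\psi}z}\,L^{2k}A_\mu g(\mathbf x,z)\,dz=0$ for every $\mathbf x\in\mathbb{R}^{2k}$. -/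

import Mathlib

open MeasureTheory Set
open scoped ContDiff

noncomputable section

namespace ConicalRadon

/-- The space `ℝⁿ × ℝ` of points `(x, z)`; the first factor carries the Euclidean norm. -/
abbrev Space (n : ℕ) : Type := EuclideanSpace ℝ (Fin n) × ℝ

/-- The unit sphere `S^{n-1}` of `ℝⁿ`. -/
abbrev Sph (n : ℕ) : Type := Metric.sphere (0 : EuclideanSpace ℝ (Fin n)) 1

/-- The surface measure on `S^{n-1}`. -/
abbrev surf (n : ℕ) : Measure (Sph n) := (volume : Measure (EuclideanSpace ℝ (Fin n))).toSphere

/-- The point `(u, v) + (z tan ψ w, z)` at height `z` above the vertex `p = (u, v)` on the cone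
with vertex `p`, vertical axis and half opening angle `ψ`. -/
def conePoint {n : ℕ} (ψ : ℝ) (p : Space n) (w : Sph n) (z : ℝ) : Space n :=
  (p.1 + (z * Real.tan ψ) • (w : EuclideanSpace ℝ (Fin n)), p.2 + z)

/-- The attenuated conical Radon transform `C_μ` (for `n ≥ 1`), written in the height variable
`z = r cos ψ`, where `r` is the distance to the vertex along the cone. -/
def coneTransform {n : ℕ} (μ ψ : ℝ) (f : Space n → ℂ) (p : Space n) : ℂ :=
  (Real.tan ψ ^ (n - 1) / Real.cos ψ) •
    ∫ w : Sph n, (∫ z in Ioi (0 : ℝ),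
      (Real.exp (-(μ / Real.cos ψ) * z) * z ^ (n - 1)) • f (conePoint ψ p w z)) ∂(surf n)

/-- The integrand of the auxiliary transform `A_μ` (for `n ≥ 2`). -/
def auxIntegrand {n : ℕ} (μ ψ : ℝ) (f : Space n → ℂ) (p : Space n) (w : Sph n) (z : ℝ) : ℂ :=
  (Real.exp (-(μ / Real.cos ψ) * z) * z ^ (n - 2)) • f (conePoint ψ p w z)

/-- The auxiliary transform `A_μ` (for `n ≥ 2`). -/
def auxTransform {n : ℕ} (μ ψ : ℝ) (f : Space n → ℂ) (p : Space n) : ℂ :=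
  (Real.tan ψ ^ (n - 1) / Real.cos ψ) •
    ∫ w : Sph n, (∫ z in Ioi (0 : ℝ), auxIntegrand μ ψ f p w z) ∂(surf n)

/-- `A_μ f` is everywhere defined: at each point `p` its integral over `S^{n-1} × (0, ∞)`
converges absolutely. -/
def AuxConverges {n : ℕ} (μ ψ : ℝ) (f : Space n → ℂ) : Prop :=
  ∀ p : Space n, Integrable (fun q : Sph n × ℝ => auxIntegrand μ ψ f p q.1 q.2)
    ((surf n).prod (volume.restrict (Ioi (0 : ℝ))))

/-- The hyperbolic operator
`L = μ²/cos²ψ - (2μ/cos ψ) ∂_z + ∂_z² - tan²ψ Δ_x`. -/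
def opL {n : ℕ} (μ ψ : ℝ) (F : Space n → ℂ) (p : Space n) : ℂ :=
  (μ ^ 2 / Real.cos ψ ^ 2) • F p
    - (2 * μ / Real.cos ψ) • deriv (fun s : ℝ => F (p.1, s)) p.2
    + iteratedDeriv 2 (fun s : ℝ => F (p.1, s)) p.2
    - (Real.tan ψ ^ 2) • Laplacian.laplacian (fun y => F (y, p.2)) p.1

/-- `C_c^∞(ℝⁿ × ℝ)`. -/
def testFunctions (n : ℕ) : Set (Space n → ℂ) :=
  {f | ContDiff ℝ ∞ f ∧ HasCompactSupport f}

/-- A tempered function: `(1 + |p|)^{-N} g(p)` is integrable for some `N`, so that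
`φ ↦ ∫ g φ` converges absolutely for Schwartz `φ` and is a tempered distribution. Every
measurable function of at most polynomial growth, in particular every bounded one, is tempered. -/
def IsTempered {n : ℕ} (g : Space n → ℂ) : Prop :=
  ∃ N : ℕ, Integrable (fun p : Space n => ((1 + ‖p‖) ^ N)⁻¹ • g p) volume

end ConicalRadon

end

noncomputable section

namespace ConicalRadon

open Filter Topology

/-! Put n = m + 2 and a = μ / cos ψ. Up to a constant, both transforms average translates over a
cone, so on superpositions of plane waves they act as multipliers, with symbols Â (weight z ^ m) and
Ĉ (weight z ^ (m + 1)). These are the moments `waveMoment` at s = a + 2πiζ and η = -2π tan ψ ξ,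
where (ξ, ζ) is the frequency, and L has symbol P = s² + |η|².

Integration by parts along rays and translation invariance of Lebesgue measure on ℝⁿ give P Ĉ = (m +
1) s Â (`waveMoment_succ`). The same relations give an ODE along rays in η, which shows that Â² P ^
(m + 1) is a nonzero constant c (`waveMoment_sq`). Hence P ^ n Â Ĉ = (m + 1) c s, that is, Lⁿ A C f
= const · (a f - ∂_z f) (`opL_iterate_avg_avg`). The right side has compact support, and e^{-az}
times it is a vertical derivative, so (i) and (ii) are necessary.

Conversely, (i) and (ii) allow const · (a f - ∂_z f) = Lⁿ A g to be solved with a test function f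
(`exists_vertical_primitive`). Then C f and g have the same image under Lⁿ A, and it remains to see
that Lⁿ A is injective on tempered functions (`eq_zero_of_opL_iterate_avg_eq_zero`). This goes by
duality: Â⁴ P ^ (2m + 2) = c², so every test function is a multiple of A³ (A Lⁿ) applied to another
one. The attenuated cone measure has all moments, so averaging preserves polynomial decay and Fubini
applies against tempered functions. -/

/-! ### Moments of damped plane waves over the cone. -/

/-- The product of the surface measure and Lebesgue measure on `S^{n-1} × (0, ∞)`. -/
abbrev polarMeasure (n : ℕ) : Measure (Sph n × ℝ) :=
  (surf n).prod (volume.restrict (Ioi (0 : ℝ)))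

/-- The damped plane wave `exp (-s z + i z ⟪η, w⟫)` in polar coordinates. -/
def polarWave {n : ℕ} (s : ℂ) (η : EuclideanSpace ℝ (Fin n)) (q : Sph n × ℝ) : ℂ :=
  Complex.exp (-(s * q.2) + Complex.I * q.2 * (inner ℝ η (q.1 : EuclideanSpace ℝ (Fin n)) : ℝ))

lemma integrableOn_pow_mul_exp_neg (m : ℕ) {b : ℝ} (hb : 0 < b) :
    IntegrableOn (fun z : ℝ => z ^ m * Real.exp (-(b * z))) (Ioi 0) := by
  have h := integrableOn_rpow_mul_exp_neg_mul_rpow (p := 1) (s := m) (b := b)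
    (by have : (0 : ℝ) ≤ m := m.cast_nonneg
        linarith) one_pos hb
  refine h.congr_fun (fun z _ => ?_) measurableSet_Ioi
  simp

lemma continuous_polarWave {n : ℕ} (s : ℂ) (η : EuclideanSpace ℝ (Fin n)) :
    Continuous (polarWave s η) := by
  unfold polarWave
  fun_prop

lemma norm_polarWave {n : ℕ} (s : ℂ) (η : EuclideanSpace ℝ (Fin n)) (q : Sph n × ℝ) :
    ‖polarWave s η q‖ = Real.exp (-(s.re * q.2)) := by
  rw [polarWave, Complex.norm_exp]
  congr 1
  simp

lemma ae_polarMeasure_pos (n : ℕ) : ∀ᵐ q ∂polarMeasure n, 0 < q.2 :=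
  Measure.quasiMeasurePreserving_snd.ae (ae_restrict_mem measurableSet_Ioi)

lemma integrable_polar_weight (n m : ℕ) {b : ℝ} (hb : 0 < b) :
    Integrable (fun q : Sph n × ℝ => q.2 ^ m * Real.exp (-(b * q.2))) (polarMeasure n) :=
  (integrableOn_pow_mul_exp_neg m hb).comp_snd _

lemma integrable_polarWave {n : ℕ} (m : ℕ) {s : ℂ} (hs : 0 < s.re)
    (η : EuclideanSpace ℝ (Fin n)) {c : Sph n × ℝ → ℂ} (hc : Continuous c) {C : ℝ}
    (hC : ∀ q, ‖c q‖ ≤ C) :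
    Integrable (fun q => (q.2 : ℂ) ^ m * c q * polarWave s η q) (polarMeasure n) := by
  refine ((integrable_polar_weight n m hs).const_mul C).mono' ?_ ?_
  · have := continuous_polarWave s η
    exact Continuous.aestronglyMeasurable (by fun_prop)
  · filter_upwards [ae_polarMeasure_pos n] with q hq
    rw [norm_mul, norm_mul, norm_polarWave, norm_pow, Complex.norm_real, Real.norm_eq_abs,
      abs_of_pos hq]
    have := hC q
    have h2 : 0 ≤ q.2 ^ m * Real.exp (-(s.re * q.2)) := by positivity
    nlinarith

/-- The moment `∫ z ^ m exp (-s z + i z ⟪η, w⟫)` over `S^{n-1} × (0, ∞)`. -/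
def waveMoment {n : ℕ} (m : ℕ) (s : ℂ) (η : EuclideanSpace ℝ (Fin n)) : ℂ :=
  ∫ q, (q.2 : ℂ) ^ m * polarWave s η q ∂polarMeasure n

/-- The moment `∫ z ^ m ⟪v, w⟫ exp (-s z + i z ⟪η, w⟫)` over `S^{n-1} × (0, ∞)`. -/
def dirMoment {n : ℕ} (m : ℕ) (s : ℂ) (η v : EuclideanSpace ℝ (Fin n)) : ℂ :=
  ∫ q : Sph n × ℝ, (q.2 : ℂ) ^ m * (inner ℝ v (q.1 : EuclideanSpace ℝ (Fin n)) : ℝ) *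
    polarWave s η q ∂polarMeasure n

lemma norm_inner_sph_le {n : ℕ} (v : EuclideanSpace ℝ (Fin n)) (w : Sph n) :
    ‖((inner ℝ v (w : EuclideanSpace ℝ (Fin n)) : ℝ) : ℂ)‖ ≤ ‖v‖ := by
  rw [Complex.norm_real]
  have := norm_inner_le_norm (𝕜 := ℝ) v (w : EuclideanSpace ℝ (Fin n))
  rwa [norm_eq_of_mem_sphere, mul_one] at this

lemma integrable_wave {n : ℕ} (m : ℕ) {s : ℂ} (hs : 0 < s.re) (η : EuclideanSpace ℝ (Fin n)) :
    Integrable (fun q => (q.2 : ℂ) ^ m * polarWave s η q) (polarMeasure n) := by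
  simpa using integrable_polarWave m hs η (c := fun _ => 1) continuous_const (C := 1) (by simp)

lemma integrable_dir {n : ℕ} (m : ℕ) {s : ℂ} (hs : 0 < s.re) (η v : EuclideanSpace ℝ (Fin n)) :
    Integrable (fun q : Sph n × ℝ => (q.2 : ℂ) ^ m *
      (inner ℝ v (q.1 : EuclideanSpace ℝ (Fin n)) : ℝ) * polarWave s η q) (polarMeasure n) :=
  integrable_polarWave m hs η (c := fun q => ((inner ℝ v (q.1 : EuclideanSpace ℝ (Fin n)) : ℝ) : ℂ))
    (by fun_prop) (fun q => norm_inner_sph_le v q.1)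

lemma tendsto_pow_mul_cexp_neg (m : ℕ) {c : ℂ} (hc : 0 < c.re) :
    Tendsto (fun z : ℝ => (z : ℂ) ^ m * Complex.exp (-(c * z))) atTop (𝓝 0) := by
  rw [tendsto_zero_iff_norm_tendsto_zero]
  have h := Real.tendsto_pow_mul_exp_neg_atTop_nhds_zero m
  have h2 := (h.comp (tendsto_id.const_mul_atTop hc)).const_mul ((c.re ^ m)⁻¹)
  rw [mul_zero] at h2
  refine h2.congr' ?_
  filter_upwards [eventually_gt_atTop 0] with z hz
  simp only [Function.comp, id, norm_mul, norm_pow, Complex.norm_real, Complex.norm_exp,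
    Real.norm_eq_abs, abs_of_pos hz, mul_pow]
  have : c.re ^ m ≠ 0 := by positivity
  field_simp
  simp

lemma integrableOn_pow_mul_cexp_neg (m : ℕ) {c : ℂ} (hc : 0 < c.re) :
    IntegrableOn (fun z : ℝ => (z : ℂ) ^ m * Complex.exp (-(c * z))) (Ioi 0) := by
  refine (integrableOn_pow_mul_exp_neg m hc).mono' (Continuous.aestronglyMeasurable (by fun_prop)) ?_
  filter_upwards [ae_restrict_mem measurableSet_Ioi] with z (hz : 0 < z)
  simp [Complex.norm_exp, abs_of_pos hz]

lemma integral_pow_succ_mul_cexp_neg (m : ℕ) {c : ℂ} (hc : 0 < c.re) :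
    c * ∫ z in Ioi (0 : ℝ), (z : ℂ) ^ (m + 1) * Complex.exp (-(c * z)) =
      (m + 1) * ∫ z in Ioi (0 : ℝ), (z : ℂ) ^ m * Complex.exp (-(c * z)) := by
  have hd : ∀ z ∈ Ici (0 : ℝ), HasDerivAt (fun z : ℝ => (z : ℂ) ^ (m + 1) * Complex.exp (-(c * z)))
      ((m + 1) * ((z : ℂ) ^ m * Complex.exp (-(c * z))) -
        c * ((z : ℂ) ^ (m + 1) * Complex.exp (-(c * z)))) z := by
    intro z _
    have h1 := (hasDerivAt_pow (m + 1) (z : ℂ)).mul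
      (((hasDerivAt_id (z : ℂ)).const_mul c).neg.cexp)
    convert! h1.comp_ofReal using 1
    simp
    ring
  have h1 := (integrableOn_pow_mul_cexp_neg m hc).const_mul ((m : ℂ) + 1)
  have h2 := (integrableOn_pow_mul_cexp_neg (m + 1) hc).const_mul c
  have := integral_Ioi_of_hasDerivAt_of_tendsto' hd (h1.sub h2) (tendsto_pow_mul_cexp_neg (m + 1) hc)
  rw [integral_sub h1 h2, integral_const_mul, integral_const_mul] at this
  simp only [Complex.ofReal_zero, ne_eq, Nat.add_eq_zero_iff, one_ne_zero, and_false,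
    not_false_eq_true, zero_pow, zero_mul, sub_zero] at this
  exact (sub_eq_zero.1 this).symm

lemma polarWave_eq {n : ℕ} (s : ℂ) (η : EuclideanSpace ℝ (Fin n)) (w : Sph n) (z : ℝ) :
    polarWave s η (w, z) =
      Complex.exp (-((s - Complex.I * (inner ℝ η (w : EuclideanSpace ℝ (Fin n)) : ℝ)) * z)) := by
  rw [polarWave]
  congr 1
  ring

/-- Integration by parts in z on each ray, where the wave is exp (-c z) with c = s - i⟪η, w⟫ and Re
c = Re s > 0. -/
lemma waveMoment_radial {n : ℕ} (m : ℕ) {s : ℂ} (hs : 0 < s.re) (η : EuclideanSpace ℝ (Fin n)) :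
    s * waveMoment (m + 1) s η - Complex.I * dirMoment (m + 1) s η η =
      (m + 1) * waveMoment m s η := by
  unfold waveMoment dirMoment
  have h1 := (integrable_wave (m + 1) hs η).const_mul s
  have h2 := (integrable_dir (m + 1) hs η η).const_mul Complex.I
  have h12 := integral_prod _ (h1.sub h2)
  simp only [Pi.sub_apply] at h12
  rw [← integral_const_mul, ← integral_const_mul, ← integral_const_mul, ← integral_sub h1 h2,
    h12, integral_prod _ ((integrable_wave m hs η).const_mul _)]
  refine integral_congr_ae (.of_forall fun w => ?_)
  have := integral_pow_succ_mul_cexp_neg m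
    (c := s - Complex.I * (inner ℝ η (w : EuclideanSpace ℝ (Fin n)) : ℝ)) (by simpa using hs)
  rw [← integral_const_mul, ← integral_const_mul] at this
  simp only [polarWave_eq, ← this]
  refine integral_congr_ae (.of_forall fun z => ?_)
  ring

lemma polarWave_hasDerivAt {n : ℕ} (s : ℂ) (η : EuclideanSpace ℝ (Fin n)) (q : Sph n × ℝ) (l : ℝ) :
    HasDerivAt (fun l : ℝ => polarWave s (l • η) q)
      (Complex.I * q.2 * (inner ℝ η (q.1 : EuclideanSpace ℝ (Fin n)) : ℝ) *
        polarWave s (l • η) q) l := by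
  simp only [polarWave, inner_smul_left, RCLike.conj_to_real, Complex.ofReal_mul]
  have h1 : HasDerivAt (fun l : ℝ => (l : ℂ)) 1 l := Complex.ofRealCLM.hasDerivAt
  have h2 := ((h1.mul_const ((inner ℝ η (q.1 : EuclideanSpace ℝ (Fin n)) : ℝ) : ℂ)).const_mul
    (Complex.I * q.2)).const_add (-(s * q.2))
  convert! h2.cexp using 1
  ring

/-- Dominated differentiation: the modulus of the wave depends only on Re s, so one bound serves for
all l. -/
lemma hasDerivAt_waveMoment {n : ℕ} (m : ℕ) {s : ℂ} (hs : 0 < s.re)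
    (η : EuclideanSpace ℝ (Fin n)) (l : ℝ) :
    HasDerivAt (fun l : ℝ => waveMoment m s (l • η))
      (Complex.I * dirMoment (m + 1) s (l • η) η) l := by
  have key := hasDerivAt_integral_of_dominated_loc_of_deriv_le (μ := polarMeasure n)
    (F := fun (l : ℝ) q => (q.2 : ℂ) ^ m * polarWave s (l • η) q)
    (F' := fun (l : ℝ) q => Complex.I * ((q.2 : ℂ) ^ (m + 1) *
      (inner ℝ η (q.1 : EuclideanSpace ℝ (Fin n)) : ℝ) * polarWave s (l • η) q))
    (bound := fun q => ‖η‖ * (q.2 ^ (m + 1) * Real.exp (-(s.re * q.2))))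
    (x₀ := l) (s := univ) univ_mem
    (.of_forall fun l => (integrable_wave m hs _).aestronglyMeasurable)
    (integrable_wave m hs _)
    ((integrable_dir (m + 1) hs (l • η) η).const_mul Complex.I).aestronglyMeasurable
    (by
      filter_upwards [ae_polarMeasure_pos n] with q hq l _
      rw [norm_mul, norm_mul, norm_mul, norm_polarWave, norm_pow, Complex.norm_real (q.2),
        Real.norm_eq_abs, abs_of_pos hq, Complex.norm_I, one_mul]
      have := norm_inner_sph_le η q.1
      have h2 : 0 ≤ q.2 ^ (m + 1) * Real.exp (-(s.re * q.2)) := by positivity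
      nlinarith)
    ((integrable_polar_weight n (m + 1) hs).const_mul _)
    (by
      refine .of_forall fun q l _ => ?_
      convert! (polarWave_hasDerivAt s η q l).const_mul ((q.2 : ℂ) ^ m) using 1
      ring)
  rw [integral_const_mul] at key
  exact key.2

/-- Serves to bring translation invariance on ℝ ^ (n + 1) to the moments; the Jacobian fixes their
exponent as n. -/
lemma integral_polar {n : ℕ} (F : EuclideanSpace ℝ (Fin (n + 1)) → ℂ) :
    ∫ y, F y = ∫ q : Sph (n + 1) × ℝ,
      (q.2 : ℂ) ^ n * F (q.2 • (q.1 : EuclideanSpace ℝ (Fin (n + 1)))) ∂polarMeasure (n + 1) := by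
  let E := EuclideanSpace ℝ (Fin (n + 1))
  have hmp := (volume : Measure E).measurePreserving_homeomorphUnitSphereProd
  have hdim : Module.finrank ℝ E - 1 = n := by simp [E]
  rw [hdim] at hmp
  have h1 := hmp.symm (homeomorphUnitSphereProd E).toMeasurableEquiv |>.integral_comp
    (homeomorphUnitSphereProd E).symm.measurableEmbedding (fun y => F y)
  rw [← restrict_compl_singleton (μ := (volume : Measure E)) 0,
    ← integral_subtype_comap (measurableSet_singleton _).compl, ← h1]
  have h2 : (Measure.volumeIoiPow n).map Subtype.val =
      (volume.restrict (Ioi (0 : ℝ))).withDensity (fun r => ENNReal.ofReal (r ^ n)) := by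
    rw [Measure.volumeIoiPow, ← map_comap_subtype_coe measurableSet_Ioi]
    ext t ht
    rw [Measure.map_apply measurable_subtype_coe ht, withDensity_apply _ ht,
      withDensity_apply _ (measurable_subtype_coe ht),
      setLIntegral_map ht (by fun_prop) measurable_subtype_coe]
  have h3 : (surf (n + 1)).prod ((volume.restrict (Ioi (0 : ℝ))).withDensity
      (fun r => ENNReal.ofReal (r ^ n))) = (polarMeasure (n + 1)).withDensity
        (fun q => ENNReal.ofReal (q.2 ^ n)) := by
    rw [prod_withDensity_right (by fun_prop)]
  have h4 : ((surf (n + 1)).prod (Measure.volumeIoiPow n)).map (Prod.map id Subtype.val) =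
      (polarMeasure (n + 1)).withDensity (fun q => ENNReal.ofReal (q.2 ^ n)) := by
    rw [← h3, ← h2, ← Measure.map_prod_map _ _ measurable_id measurable_subtype_coe, Measure.map_id]
  have hemb : MeasurableEmbedding (Prod.map id Subtype.val : Sph (n + 1) × Ioi (0 : ℝ) → _) :=
    MeasurableEmbedding.id.prodMap (MeasurableEmbedding.subtype_coe measurableSet_Ioi)
  have h5 := hemb.integral_map (μ := (surf (n + 1)).prod (Measure.volumeIoiPow n))
    (fun q : Sph (n + 1) × ℝ => F (q.2 • (q.1 : E)))
  rw [h4, integral_withDensity_eq_integral_toReal_smul (by fun_prop)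
    (.of_forall fun _ => ENNReal.ofReal_lt_top)] at h5
  refine Eq.trans ?_ (h5.symm.trans ?_)
  · refine integral_congr_ae (.of_forall fun q => ?_)
    simp [homeomorphUnitSphereProd_symm_apply_coe]
  · refine integral_congr_ae ?_
    filter_upwards [ae_polarMeasure_pos (n + 1)] with q hq
    rw [ENNReal.toReal_ofReal (by positivity), Complex.real_smul]
    simp

/-! ### Translation invariance applied to a damped wave. -/

section Translation

variable {E : Type*} [NormedAddCommGroup E] [InnerProductSpace ℝ E]

/-- The damped plane wave `exp (-s ‖y‖ + i ⟪η, y⟫)`. -/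
def dampedWave (s : ℂ) (η y : E) : ℂ :=
  Complex.exp (-(s * ‖y‖) + Complex.I * (inner ℝ η y : ℝ))

lemma continuous_dampedWave (s : ℂ) (η : E) : Continuous (dampedWave s η) := by
  unfold dampedWave
  fun_prop

lemma norm_dampedWave (s : ℂ) (η y : E) : ‖dampedWave s η y‖ = Real.exp (-(s.re * ‖y‖)) := by
  rw [dampedWave, Complex.norm_exp]
  congr 1
  simp

/-- Mean value inequality on the convex half-plane Re z ≤ M, where |exp'| ≤ e ^ M. -/
lemma norm_cexp_sub_le {A B : ℂ} {M : ℝ} (hA : A.re ≤ M) (hB : B.re ≤ M) :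
    ‖Complex.exp B - Complex.exp A‖ ≤ Real.exp M * ‖B - A‖ := by
  refine Convex.norm_image_sub_le_of_norm_deriv_le (s := {z : ℂ | z.re ≤ M})
    (fun x _ => Complex.differentiableAt_exp) (fun x hx => ?_) (convex_halfSpace_re_le M) hA hB
  rw [Complex.deriv_exp, Complex.norm_exp]
  exact Real.exp_le_exp.2 hx

/-- A Lipschitz bound replaces a derivative bound because the segment y + h v may cross the origin,
where the norm is not differentiable. The constant is integrable in y. -/
lemma dampedWave_lipschitz {s : ℂ} (hs : 0 < s.re) (η v y : E) :
    LipschitzOnWith (Real.nnabs ((‖s‖ * ‖v‖ + ‖η‖ * ‖v‖) * Real.exp (s.re * ‖v‖) *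
      Real.exp (-(s.re * ‖y‖)))) (fun h : ℝ => dampedWave s η (y + h • v)) (Metric.ball 0 1) := by
  refine LipschitzOnWith.of_dist_le_mul fun h hh h' hh' => ?_
  have hre : ∀ h ∈ Metric.ball (0 : ℝ) 1, (-(s * ‖y + h • v‖) + Complex.I *
      (inner ℝ η (y + h • v) : ℝ)).re ≤ s.re * ‖v‖ + -(s.re * ‖y‖) := by
    intro h hh
    have h1 : ‖y‖ ≤ ‖y + h • v‖ + ‖h • v‖ := by
      simpa using norm_sub_le (y + h • v) (h • v)
    have h2 : ‖h • v‖ ≤ ‖v‖ := by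
      rw [norm_smul]
      have : ‖h‖ < 1 := by simpa using hh
      nlinarith [norm_nonneg v]
    simp
    nlinarith
  have key := norm_cexp_sub_le (hre h' hh') (hre h hh)
  rw [dist_eq_norm, dist_eq_norm]
  refine key.trans ?_
  rw [Real.coe_nnabs, abs_of_nonneg (by positivity), Real.exp_add]
  have h3 : ‖-(s * (‖y + h • v‖ : ℂ)) + Complex.I * (inner ℝ η (y + h • v) : ℝ) -
      (-(s * (‖y + h' • v‖ : ℂ)) + Complex.I * (inner ℝ η (y + h' • v) : ℝ))‖ ≤
      (‖s‖ * ‖v‖ + ‖η‖ * ‖v‖) * ‖h - h'‖ := by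
    have e : -(s * (‖y + h • v‖ : ℂ)) + Complex.I * (inner ℝ η (y + h • v) : ℝ) -
      (-(s * (‖y + h' • v‖ : ℂ)) + Complex.I * (inner ℝ η (y + h' • v) : ℝ)) =
      -(s * ((‖y + h • v‖ - ‖y + h' • v‖ : ℝ) : ℂ)) +
        Complex.I * ((h - h') * inner ℝ η v : ℝ) := by
      simp only [inner_add_right, inner_smul_right]
      push_cast
      ring
    rw [e]
    refine (norm_add_le _ _).trans ?_
    rw [norm_neg, norm_mul, norm_mul, Complex.norm_real, Complex.norm_real, Complex.norm_I, one_mul,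
      norm_mul]
    have h4 : ‖‖y + h • v‖ - ‖y + h' • v‖‖ ≤ ‖h - h'‖ * ‖v‖ := by
      refine (abs_norm_sub_norm_le _ _).trans_eq ?_
      rw [add_sub_add_left_eq_sub, ← sub_smul, norm_smul]
    have h5 := norm_inner_le_norm (𝕜 := ℝ) η v
    have := mul_le_mul_of_nonneg_left h4 (norm_nonneg s)
    have := mul_le_mul_of_nonneg_left h5 (norm_nonneg (h - h'))
    linarith
  have := mul_le_mul_of_nonneg_left h3
    (mul_nonneg (Real.exp_nonneg (s.re * ‖v‖)) (Real.exp_nonneg (-(s.re * ‖y‖))))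
  linarith

lemma dampedWave_hasDerivAt (s : ℂ) (η v : E) {y : E} (hy : y ≠ 0) :
    HasDerivAt (fun h : ℝ => dampedWave s η (y + h • v))
      ((Complex.I * (inner ℝ η v : ℝ) - s * (inner ℝ v y / ‖y‖ : ℝ)) * dampedWave s η y) 0 := by
  have h0 : HasDerivAt (fun h : ℝ => y + h • v) v 0 := by
    simpa using ((hasDerivAt_id (0 : ℝ)).smul_const v).const_add y
  have h1 : HasDerivAt (fun h : ℝ => ‖y + h • v‖) (inner ℝ v y / ‖y‖) 0 := by
    have := h0.norm_sq.sqrt (by simpa using hy)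
    simp only [Real.sqrt_sq (norm_nonneg _), zero_smul, add_zero] at this
    convert! this using 1
    rw [real_inner_comm]
    field_simp
  have h2 : HasDerivAt (fun h : ℝ => inner ℝ η (y + h • v)) (inner ℝ η v) 0 := by
    simpa using (hasDerivAt_const (0 : ℝ) η).inner ℝ h0
  have h3 := ((h1.ofReal_comp.const_mul s).neg.add (h2.ofReal_comp.const_mul Complex.I)).cexp
  convert! h3 using 1
  simp [dampedWave]
  ring

variable [FiniteDimensional ℝ E] [MeasurableSpace E] [BorelSpace E] [Nontrivial E]

lemma integrable_exp_neg_norm {b : ℝ} (hb : 0 < b) :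
    Integrable (fun y : E => Real.exp (-(b * ‖y‖))) := by
  rw [integrable_fun_norm_addHaar volume (f := fun r => Real.exp (-(b * r)))]
  exact integrableOn_pow_mul_exp_neg _ hb

/-- The integral of the wave translated by h v does not depend on h; its derivative at h = 0 is the
integral in question. The derivative formula is needed only for almost every y, so y = 0 is
harmless. -/
lemma integral_translation_dampedWave {s : ℂ} (hs : 0 < s.re) (η v : E) :
    Integrable (fun y => (Complex.I * (inner ℝ η v : ℝ) - s * (inner ℝ v y / ‖y‖ : ℝ)) *
      dampedWave s η y) ∧
    ∫ y, (Complex.I * (inner ℝ η v : ℝ) - s * (inner ℝ v y / ‖y‖ : ℝ)) * dampedWave s η y = 0 := by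
  have hint : Integrable (dampedWave s η) :=
    (integrable_exp_neg_norm hs).mono' (continuous_dampedWave s η).aestronglyMeasurable
      (.of_forall fun y => (norm_dampedWave s η y).le)
  have hm : Measurable fun y : E => (Complex.I * (inner ℝ η v : ℝ) - s * (inner ℝ v y / ‖y‖ : ℝ)) *
      dampedWave s η y := by
    have := (continuous_dampedWave s η).measurable
    fun_prop
  have key := hasDerivAt_integral_of_dominated_loc_of_lip (μ := (volume : Measure E))
    (F := fun (h : ℝ) y => dampedWave s η (y + h • v)) (x₀ := 0)
    (Metric.ball_mem_nhds (0 : ℝ) one_pos)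
    (.of_forall fun h => ((continuous_dampedWave s η).comp (by fun_prop)).aestronglyMeasurable)
    (by simpa using hint) hm.aestronglyMeasurable
    (.of_forall fun y => dampedWave_lipschitz hs η v y)
    ((integrable_exp_neg_norm hs).const_mul _)
    (by
      filter_upwards [measure_eq_zero_iff_ae_notMem.1 (measure_singleton (μ := volume) (0 : E))]
        with y hy using dampedWave_hasDerivAt s η v hy)
  refine ⟨key.1, ?_⟩
  have h1 := key.2
  simp only [integral_add_right_eq_self (dampedWave s η)] at h1
  exact h1.unique (hasDerivAt_const _ _)

end Translation

/-! ### Evaluation of the moments. -/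

lemma waveMoment_translation {n : ℕ} {s : ℂ} (hs : 0 < s.re)
    (η v : EuclideanSpace ℝ (Fin (n + 1))) :
    Complex.I * (inner ℝ η v : ℝ) * waveMoment n s η = s * dirMoment n s η v := by
  have h := (integral_translation_dampedWave hs η v).2
  rw [integral_polar] at h
  unfold waveMoment dirMoment
  rw [← sub_eq_zero, ← integral_const_mul, ← integral_const_mul,
    ← integral_sub ((integrable_wave n hs η).const_mul _) ((integrable_dir n hs η v).const_mul _),
    ← h]
  refine integral_congr_ae ?_
  filter_upwards [ae_polarMeasure_pos (n + 1)] with q hq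
  have h1 : ‖q.2 • (q.1 : EuclideanSpace ℝ (Fin (n + 1)))‖ = q.2 := by
    rw [norm_smul, norm_eq_of_mem_sphere, mul_one, Real.norm_of_nonneg hq.le]
  rw [dampedWave, polarWave, h1, inner_smul_right, inner_smul_right, mul_div_cancel_left₀ _ hq.ne']
  push_cast
  ring_nf

/-- The translation identity with v = η eliminates `dirMoment` from the radial identity. The former
holds only for exponent dim - 1, which ties the pair m, m + 1 to dimension m + 2. -/
lemma waveMoment_succ {m : ℕ} {s : ℂ} (hs : 0 < s.re) (η : EuclideanSpace ℝ (Fin (m + 2))) :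
    (s ^ 2 + (‖η‖ : ℂ) ^ 2) * waveMoment (m + 1) s η = (m + 1) * s * waveMoment m s η := by
  have h1 := waveMoment_translation hs η η
  have h2 := waveMoment_radial m hs η
  rw [real_inner_self_eq_norm_sq] at h1
  push_cast at h1
  linear_combination s * h2 - Complex.I * h1 + (‖η‖ : ℂ) ^ 2 * waveMoment (m + 1) s η * Complex.I_sq

lemma waveMoment_zero {n : ℕ} (m : ℕ) {s : ℂ} (hs : 0 < s.re) :
    waveMoment m s (0 : EuclideanSpace ℝ (Fin n)) * s ^ (m + 1) =
      (surf n).real univ * (m.factorial : ℂ) := by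
  have hpow : ∀ m : ℕ, (∫ z in Ioi (0 : ℝ), (z : ℂ) ^ m * Complex.exp (-(s * z))) * s ^ (m + 1) =
      (m.factorial : ℂ) := by
    intro m
    induction m with
    | zero =>
      have hne : s ≠ 0 := by
        rintro rfl
        simp at hs
      have h0 := integral_exp_mul_complex_Ioi (a := -s) (by simpa using hs) 0
      simp only [neg_mul] at h0
      simp [h0, hne]
    | succ m ih =>
      rw [pow_succ' s, ← mul_assoc, mul_comm _ s, integral_pow_succ_mul_cexp_neg m hs, mul_assoc, ih,
        Nat.factorial_succ]
      push_cast
      ring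
  unfold waveMoment
  have h := integral_prod _ (integrable_wave m hs (0 : EuclideanSpace ℝ (Fin n)))
  rw [h]
  simp only [polarWave_eq, inner_zero_left, Complex.ofReal_zero, mul_zero, sub_zero,
    integral_const, Complex.real_smul]
  rw [mul_assoc, hpow]

/-- The square of the symbol of the auxiliary transform. -/
lemma waveMoment_sq {m : ℕ} {s : ℂ} (hs : 0 < s.re) (η : EuclideanSpace ℝ (Fin (m + 2))) :
    waveMoment m s η ^ 2 * (s ^ 2 + (‖η‖ : ℂ) ^ 2) ^ (m + 1) =
      ((surf (m + 2)).real univ * (m.factorial : ℂ)) ^ 2 := by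
  -- The squared product is constant on the ray l • η. Squaring avoids a branch of the power (m + 1)
  -- / 2.
  set f : ℝ → ℂ := fun l => waveMoment m s (l • η) ^ 2 *
    (s ^ 2 + (l : ℂ) ^ 2 * (‖η‖ : ℂ) ^ 2) ^ (m + 1) with hf
  have hd : ∀ l : ℝ, HasDerivAt f 0 l := by
    intro l
    have h1 := hasDerivAt_waveMoment m hs η l
    have hl : HasDerivAt (fun l : ℝ => (l : ℂ)) 1 l := Complex.ofRealCLM.hasDerivAt
    have h2 := (((hl.pow 2).mul_const ((‖η‖ : ℂ) ^ 2)).const_add (s ^ 2)).pow (m + 1)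
    refine ((h1.pow 2).mul h2).congr_deriv ?_
    have ht := waveMoment_translation hs (l • η) η
    have hr := waveMoment_succ hs (l • η)
    rw [inner_smul_left, real_inner_self_eq_norm_sq] at ht
    rw [norm_smul] at hr
    have hl2 : ((‖l‖ * ‖η‖ : ℝ) : ℂ) ^ 2 = (l : ℂ) ^ 2 * (‖η‖ : ℂ) ^ 2 := by
      rw [← Complex.ofReal_pow, mul_pow, Real.norm_eq_abs, sq_abs]
      push_cast
      ring
    rw [hl2] at hr
    simp only [RCLike.conj_to_real] at ht
    push_cast at ht
    have hne : s ≠ 0 := by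
      rintro rfl
      simp at hs
    set Q := s ^ 2 + (l : ℂ) ^ 2 * (‖η‖ : ℂ) ^ 2
    set T := dirMoment (m + 1) s (l • η) η
    set J1 := waveMoment (m + 1) s (l • η)
    set J := waveMoment m s (l • η)
    -- The ODE Q J' = -(m + 1) l ‖η‖² J, since J' = i T: the translation identity expresses T by J1,
    -- the recursion expresses Q J1 by J, and s cancels.
    have hQ : Q * (Complex.I * T) = -((m + 1) * l * (‖η‖ : ℂ) ^ 2 * J) := by
      apply mul_left_cancel₀ hne
      linear_combination (-Q * Complex.I) * ht - (l : ℂ) * (‖η‖ : ℂ) ^ 2 * hr +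
        l * (‖η‖ : ℂ) ^ 2 * J1 * Q * Complex.I_sq
    simp only [Nat.add_sub_cancel, Pi.pow_apply, pow_succ]
    push_cast
    linear_combination 2 * J * Q ^ m * hQ
  have hc := is_const_of_deriv_eq_zero (fun l => (hd l).differentiableAt)
    (fun l => (hd l).deriv) 1 0
  simp only [hf, one_smul, Complex.ofReal_one, one_pow, one_mul, zero_smul, Complex.ofReal_zero,
    ne_eq, OfNat.ofNat_ne_zero, not_false_eq_true, zero_pow, zero_mul, add_zero] at hc
  rw [hc, ← waveMoment_zero m hs]
  ring

/-! ### The operator L through directional derivatives. -/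

section DirectionalDerivatives

variable {X : Type*} [NormedAddCommGroup X] [NormedSpace ℝ X]

/-- The derivative of `F` in the direction `v`. -/
def dirDeriv (v : X) (F : X → ℂ) (p : X) : ℂ := fderiv ℝ F p v

lemma contDiff_dirDeriv {F : X → ℂ} (hF : ContDiff ℝ ∞ F) (v : X) :
    ContDiff ℝ ∞ (dirDeriv v F) :=
  (hF.fderiv_right (m := ∞) (by simp)).clm_apply contDiff_const

lemma hasCompactSupport_dirDeriv {F : X → ℂ} (hF : HasCompactSupport F) (v : X) :
    HasCompactSupport (dirDeriv v F) :=
  hF.fderiv_apply ℝ v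

end DirectionalDerivatives

/-- The unit vector in the vertical direction. -/
def vert (n : ℕ) : Space n := (0, 1)

/-- The horizontal unit vector in the `i`-th coordinate direction. -/
def horiz {n : ℕ} (i : Fin n) : Space n := (EuclideanSpace.basisFun (Fin n) ℝ i, 0)

lemma deriv_vertical {n : ℕ} {F : Space n → ℂ} (hF : Differentiable ℝ F)
    (x : EuclideanSpace ℝ (Fin n)) (s : ℝ) : HasDerivAt (fun s : ℝ => F (x, s)) (dirDeriv (vert n) F (x, s)) s := by
  have h : HasDerivAt (fun s : ℝ => ((x, s) : Space n)) (vert n) s :=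
    (hasDerivAt_const s x).prodMk (hasDerivAt_id s)
  exact (hF (x, s)).hasFDerivAt.comp_hasDerivAt s h

lemma fderiv_horizontal {n : ℕ} {F : Space n → ℂ} (hF : Differentiable ℝ F) (s : ℝ) (i : Fin n) :
    (fun x => fderiv ℝ (fun y => F (y, s)) x (EuclideanSpace.basisFun (Fin n) ℝ i)) =
      fun x => dirDeriv (horiz i) F (x, s) := by
  ext x
  have h : HasFDerivAt (fun y => ((y, s) : Space n))
      (ContinuousLinearMap.inl ℝ (EuclideanSpace ℝ (Fin n)) ℝ) x := hasFDerivAt_prodMk_left x s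
  have h2 : HasFDerivAt (fun y => F (y, s)) _ x := (hF (x, s)).hasFDerivAt.comp x h
  rw [h2.fderiv]
  rfl

/-- `opL` in terms of directional derivatives. -/
lemma opL_eq {n : ℕ} (μ ψ : ℝ) {F : Space n → ℂ} (hF : ContDiff ℝ ∞ F) :
    opL μ ψ F = fun p => (((μ / Real.cos ψ) ^ 2 : ℝ) : ℂ) * F p
      - ((2 * (μ / Real.cos ψ) : ℝ) : ℂ) * dirDeriv (vert n) F p
      + dirDeriv (vert n) (dirDeriv (vert n) F) p
      - ((Real.tan ψ ^ 2 : ℝ) : ℂ) * ∑ i, dirDeriv (horiz i) (dirDeriv (horiz i) F) p := by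
  ext p
  have hd : Differentiable ℝ F := hF.differentiable (by simp)
  have h1 : ∀ x : EuclideanSpace ℝ (Fin n), deriv (fun s : ℝ => F (x, s)) =
      fun s => dirDeriv (vert n) F (x, s) := fun x => funext fun s => (deriv_vertical hd x s).deriv
  have h2 : iteratedDeriv 2 (fun s : ℝ => F (p.1, s)) p.2 =
      dirDeriv (vert n) (dirDeriv (vert n) F) p := by
    rw [iteratedDeriv_succ, iteratedDeriv_one, h1]
    exact (deriv_vertical ((contDiff_dirDeriv hF _).differentiable (by simp)) p.1 p.2).deriv
  have h3 : Laplacian.laplacian (fun y => F (y, p.2)) p.1 =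
      ∑ i, dirDeriv (horiz i) (dirDeriv (horiz i) F) p := by
    rw [congrFun (InnerProductSpace.laplacian_eq_iteratedFDeriv_orthonormalBasis _
      (EuclideanSpace.basisFun (Fin n) ℝ)) p.1]
    refine Finset.sum_congr rfl fun i _ => ?_
    rw [iteratedFDeriv_two_apply]
    simp only [Matrix.cons_val_zero, Matrix.cons_val_one]
    have h4 : ContDiff ℝ ∞ (fun y => F (y, p.2)) := hF.comp (contDiff_prodMk_left _)
    have h5 := (h4.fderiv_right (m := ∞) (by simp)).differentiable (by simp) p.1
    have h6 := (h5.hasFDerivAt.clm_apply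
      (hasFDerivAt_const (EuclideanSpace.basisFun (Fin n) ℝ i) p.1)).fderiv
    have h7 := congrArg (fun T => T (EuclideanSpace.basisFun (Fin n) ℝ i)) h6
    simp only [ContinuousLinearMap.comp_zero, zero_add, ContinuousLinearMap.flip_apply] at h7
    rw [← h7, fderiv_horizontal hd p.2 i]
    exact congrFun (fderiv_horizontal ((contDiff_dirDeriv hF _).differentiable (by simp)) p.2 i) p.1
  rw [opL, h2, h3, h1]
  simp only [Complex.real_smul, div_pow, mul_div_assoc]

lemma contDiff_opL {n : ℕ} (μ ψ : ℝ) {F : Space n → ℂ} (hF : ContDiff ℝ ∞ F) :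
    ContDiff ℝ ∞ (opL μ ψ F) := by
  rw [opL_eq μ ψ hF]
  have h1 := contDiff_dirDeriv hF (vert n)
  have h2 := contDiff_dirDeriv h1 (vert n)
  have h3 : ContDiff ℝ ∞ fun p => ∑ i, dirDeriv (horiz i)
      (dirDeriv (horiz i) F) p :=
    ContDiff.sum fun i _ => contDiff_dirDeriv (contDiff_dirDeriv hF (horiz i)) (horiz i)
  fun_prop

lemma contDiff_opL_iterate {n : ℕ} (μ ψ : ℝ) {F : Space n → ℂ} (hF : ContDiff ℝ ∞ F) (j : ℕ) :
    ContDiff ℝ ∞ ((opL μ ψ)^[j] F) := by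
  induction j with
  | zero => exact hF
  | succ j ih =>
    rw [Function.iterate_succ_apply']
    exact contDiff_opL μ ψ ih

lemma hasCompactSupport_opL {n : ℕ} (μ ψ : ℝ) {F : Space n → ℂ} (hF : ContDiff ℝ ∞ F)
    (hc : HasCompactSupport F) : HasCompactSupport (opL μ ψ F) := by
  rw [opL_eq μ ψ hF]
  have h1 := hasCompactSupport_dirDeriv hc (vert n)
  have h2 := hasCompactSupport_dirDeriv h1 (vert n)
  have h3 : HasCompactSupport fun p => ∑ i, dirDeriv (horiz i)
      (dirDeriv (horiz i) F) p := by
    have : ∀ s : Finset (Fin n), HasCompactSupport fun p => ∑ i ∈ s, dirDeriv (horiz i)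
      (dirDeriv (horiz i) F) p := by
      intro s
      induction s using Finset.induction_on with
      | empty => exact HasCompactSupport.zero
      | insert i s hi ih =>
        simp only [Finset.sum_insert hi]
        exact (hasCompactSupport_dirDeriv (hasCompactSupport_dirDeriv hc (horiz i)) (horiz i)).add ih
    exact this _
  exact (((hc.mul_left).sub h1.mul_left).add h2).sub h3.mul_left

lemma hasCompactSupport_opL_iterate {n : ℕ} (μ ψ : ℝ) {F : Space n → ℂ} (hF : ContDiff ℝ ∞ F)
    (hc : HasCompactSupport F) (j : ℕ) : HasCompactSupport ((opL μ ψ)^[j] F) := by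
  induction j with
  | zero => exact hc
  | succ j ih =>
    rw [Function.iterate_succ_apply']
    exact hasCompactSupport_opL μ ψ (contDiff_opL_iterate μ ψ hF j) ih

/-! ### Superpositions of plane waves and the multiplier of L. -/

section Synthesis

/-- The frequency space, dual to `Space n`. -/
abbrev Freq (n : ℕ) : Type := WithLp 2 (EuclideanSpace ℝ (Fin n) × ℝ)

/-- The pairing of frequencies and points. -/
def pairing (n : ℕ) : Freq n →L[ℝ] Space n →L[ℝ] ℝ :=
  (innerSL ℝ).bilinearComp (ContinuousLinearMap.id ℝ (Freq n))
    (WithLp.prodContinuousLinearEquiv 2 ℝ (EuclideanSpace ℝ (Fin n)) ℝ).symm.toContinuousLinearMap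

lemma pairing_apply {n : ℕ} (v : Freq n) (p : Space n) :
    pairing n v p = inner ℝ v.fst p.1 + v.snd * p.2 := by
  have : pairing n v p = inner ℝ v (WithLp.toLp 2 p) := rfl
  rw [this, WithLp.prod_inner_apply]
  simp [mul_comm]

/-- The superposition of plane waves with density `h`. -/
def synth {n : ℕ} (h : Freq n → ℂ) : Space n → ℂ :=
  VectorFourier.fourierIntegral Real.fourierChar volume (pairing n).toLinearMap₁₂ h

/-- A density all of whose moments are finite. -/
structure Rapid {n : ℕ} (h : Freq n → ℂ) : Prop where
  meas : AEStronglyMeasurable h volume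
  moment : ∀ N : ℕ, Integrable fun v => ‖v‖ ^ N * ‖h v‖

variable {n : ℕ} {h h₁ h₂ : Freq n → ℂ}

lemma Rapid.integrable (hh : Rapid h) : Integrable h := by
  have := hh.moment 0
  simp only [pow_zero, one_mul] at this
  exact (integrable_norm_iff hh.meas).1 this

lemma Rapid.add (h1 : Rapid h₁) (h2 : Rapid h₂) : Rapid fun v => h₁ v + h₂ v := by
  refine ⟨h1.meas.add h2.meas, fun N => ((h1.moment N).add (h2.moment N)).mono'
    (((continuous_norm.pow N).aestronglyMeasurable).mul (h1.meas.add h2.meas).norm)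
    (.of_forall fun v => ?_)⟩
  rw [Real.norm_of_nonneg (by positivity)]
  have := mul_le_mul_of_nonneg_left (norm_add_le (h₁ v) (h₂ v)) (pow_nonneg (norm_nonneg v) N)
  simpa [mul_add] using this

lemma Rapid.mul_of_bound (hh : Rapid h) {b : Freq n → ℂ} (hb : AEStronglyMeasurable b volume)
    (C : ℝ) (M : ℕ) (hC : ∀ v, ‖b v‖ ≤ C * ‖v‖ ^ M) : Rapid fun v => b v * h v := by
  refine ⟨hb.mul hh.meas, fun N => ((hh.moment (N + M)).const_mul C).mono'
    (((continuous_norm.pow N).aestronglyMeasurable).mul (hb.mul hh.meas).norm)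
    (.of_forall fun v => ?_)⟩
  rw [Real.norm_of_nonneg (by positivity), norm_mul]
  have := mul_le_mul_of_nonneg_right (hC v)
    (mul_nonneg (norm_nonneg (h v)) (pow_nonneg (norm_nonneg v) N))
  calc _ = ‖b v‖ * (‖h v‖ * ‖v‖ ^ N) := by ring
    _ ≤ _ := this
    _ = _ := by ring

lemma Rapid.const_mul (hh : Rapid h) (c : ℂ) : Rapid fun v => c * h v :=
  hh.mul_of_bound (b := fun _ => c) aestronglyMeasurable_const ‖c‖ 0 (by simp)

lemma Rapid.sum {ι : Type*} (s : Finset ι) {H : ι → Freq n → ℂ} (hH : ∀ i, Rapid (H i)) :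
    Rapid fun v => ∑ i ∈ s, H i v := by
  classical
  induction s using Finset.induction_on with
  | empty => exact ⟨by simpa using aestronglyMeasurable_const, by simp⟩
  | insert i s hi ih =>
    simp only [Finset.sum_insert hi]
    exact (hH i).add ih

/-- The multiplier of the derivative in the direction `w`. -/
def derivSymbol (w : Space n) (v : Freq n) : ℂ := -(2 * Real.pi * Complex.I) * (pairing n v w : ℝ)

lemma Rapid.derivSymbol_mul (hh : Rapid h) (w : Space n) : Rapid fun v => derivSymbol w v * h v := by
  have hc : Continuous (derivSymbol w : Freq n → ℂ) := by
    unfold derivSymbol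
    have : Continuous fun v : Freq n => pairing n v w := by fun_prop
    fun_prop
  refine hh.mul_of_bound hc.aestronglyMeasurable (2 * Real.pi * (‖pairing n‖ * ‖w‖)) 1 fun v => ?_
  have := (pairing n).le_opNorm₂ v w
  rw [derivSymbol, norm_mul, norm_neg, Complex.norm_real]
  have h2 : ‖(2 * Real.pi * Complex.I : ℂ)‖ = 2 * Real.pi := by simp [Real.pi_pos.le]
  rw [h2, pow_one]
  have := mul_le_mul_of_nonneg_left this Real.two_pi_pos.le
  linarith

lemma norm_char (x : ℝ) : ‖(Real.fourierChar x : ℂ)‖ = 1 := Circle.norm_coe _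

lemma synth_apply (h : Freq n → ℂ) (p : Space n) :
    synth h p = ∫ v, (Real.fourierChar (-(pairing n v p)) : ℂ) * h v := by
  simp only [synth, VectorFourier.fourierIntegral, Circle.smul_def, smul_eq_mul]
  rfl

lemma integrable_char_mul (hh : Integrable h) (p : Space n) :
    Integrable fun v => (Real.fourierChar (-(pairing n v p)) : ℂ) * h v := by
  refine hh.bdd_mul (c := 1) (Continuous.aestronglyMeasurable ?_) (.of_forall fun v => (norm_char _).le)
  fun_prop

lemma synth_add (h1 : Rapid h₁) (h2 : Rapid h₂) :
    synth (fun v => h₁ v + h₂ v) = fun p => synth h₁ p + synth h₂ p := by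
  ext p
  simp only [synth_apply, mul_add]
  exact integral_add (integrable_char_mul h1.integrable p) (integrable_char_mul h2.integrable p)

lemma synth_const_mul (c : ℂ) (h : Freq n → ℂ) :
    synth (fun v => c * h v) = fun p => c * synth h p := by
  ext p
  simp only [synth_apply, ← integral_const_mul]
  exact integral_congr_ae (.of_forall fun v => by ring)

lemma synth_sum {ι : Type*} (s : Finset ι) {H : ι → Freq n → ℂ} (hH : ∀ i, Rapid (H i)) :
    synth (fun v => ∑ i ∈ s, H i v) = fun p => ∑ i ∈ s, synth (H i) p := by
  ext p
  simp only [synth_apply, Finset.mul_sum]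
  exact integral_finsetSum _ fun i _ => integrable_char_mul (hH i).integrable p

lemma Rapid.contDiff_synth (hh : Rapid h) : ContDiff ℝ ∞ (synth h) :=
  VectorFourier.contDiff_fourierIntegral (N := ⊤) (pairing n) fun N _ => hh.moment N

lemma Rapid.dirDeriv_synth (hh : Rapid h) (w : Space n) :
    dirDeriv w (synth h) = synth fun v => derivSymbol w v * h v := by
  ext p
  have h1 := hh.moment 1
  simp only [pow_one] at h1
  rw [dirDeriv, synth, VectorFourier.fderiv_fourierIntegral (pairing n) hh.integrable h1,
    VectorFourier.fourierIntegral, synth_apply,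
    ContinuousLinearMap.integral_apply]
  · refine integral_congr_ae (.of_forall fun v => ?_)
    simp only [FunLike.coe_smul, Pi.smul_apply, VectorFourier.fourierSMulRight_apply,
      Circle.smul_def, smul_eq_mul, derivSymbol, Complex.real_smul]
    simp
    ring
  · have h2 := (VectorFourier.fourierIntegral_convergent_iff Real.continuous_fourierChar
      (by apply (pairing n).continuous₂ :
        Continuous (fun q : Freq n × Space n => (pairing n).toLinearMap₁₂ q.1 q.2)) p
      (f := VectorFourier.fourierSMulRight (pairing n) h) (μ := volume)).2
    refine h2 ((h1.const_mul (2 * Real.pi * ‖pairing n‖)).mono' hh.meas.fourierSMulRight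
      (.of_forall fun v => ?_))
    have := VectorFourier.norm_fourierSMulRight_le (pairing n) h v
    linarith

/-- The multiplier of `opL`. -/
def opSymbol (μ ψ : ℝ) (v : Freq n) : ℂ :=
  ((μ / Real.cos ψ : ℝ) + 2 * Real.pi * Complex.I * v.snd) ^ 2 +
    (2 * Real.pi * Real.tan ψ * ‖v.fst‖ : ℝ) ^ 2

lemma opSymbol_eq (μ ψ : ℝ) (v : Freq n) :
    opSymbol μ ψ v = ((μ / Real.cos ψ) ^ 2 : ℝ)
      + -((2 * (μ / Real.cos ψ) : ℝ) : ℂ) * derivSymbol (vert n) v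
      + derivSymbol (vert n) v * derivSymbol (vert n) v
      + -((Real.tan ψ ^ 2 : ℝ) : ℂ) * ∑ i, derivSymbol (horiz i) v * derivSymbol (horiz i) v := by
  have h1 : derivSymbol (vert n) v = -(2 * Real.pi * Complex.I) * v.snd := by
    simp [derivSymbol, pairing_apply, vert]
  have h2 : ∑ i, derivSymbol (horiz i) v * derivSymbol (horiz i) v =
      (2 * Real.pi * Complex.I) ^ 2 * (‖v.fst‖ : ℂ) ^ 2 := by
    have h3 : (‖v.fst‖ : ℂ) ^ 2 = ∑ i, ((v.fst i : ℝ) : ℂ) ^ 2 := by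
      rw [← Complex.ofReal_pow, EuclideanSpace.real_norm_sq_eq]
      push_cast
      rfl
    rw [h3, Finset.mul_sum]
    refine Finset.sum_congr rfl fun i _ => ?_
    have h4 : pairing n v (horiz i) = v.fst i := by
      simp [pairing_apply, horiz, EuclideanSpace.inner_single_right]
    rw [derivSymbol, h4]
    ring
  rw [h1, h2, opSymbol]
  generalize Real.tan ψ = t
  push_cast
  linear_combination (-4 * (Real.pi : ℂ) ^ 2 * t ^ 2 * (‖v.fst‖ : ℂ) ^ 2) * -Complex.I_sq

lemma opSymbol_mul_eq (μ ψ : ℝ) (h : Freq n → ℂ) :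
    (fun v => opSymbol μ ψ v * h v) = fun v => ((((μ / Real.cos ψ) ^ 2 : ℝ) : ℂ) * h v
      + -((2 * (μ / Real.cos ψ) : ℝ) : ℂ) * (derivSymbol (vert n) v * h v)
      + derivSymbol (vert n) v * (derivSymbol (vert n) v * h v))
      + -((Real.tan ψ ^ 2 : ℝ) : ℂ) *
        ∑ i, derivSymbol (horiz i) v * (derivSymbol (horiz i) v * h v) := by
  ext v
  rw [opSymbol_eq]
  simp only [← mul_assoc]
  rw [← Finset.sum_mul]
  ring

lemma Rapid.opSymbol_mul (hh : Rapid h) (μ ψ : ℝ) : Rapid fun v => opSymbol μ ψ v * h v := by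
  rw [opSymbol_mul_eq]
  exact (((hh.const_mul _).add ((hh.derivSymbol_mul _).const_mul _)).add
    ((hh.derivSymbol_mul _).derivSymbol_mul _)).add
    ((Rapid.sum _ fun i => (hh.derivSymbol_mul (horiz i)).derivSymbol_mul (horiz i)).const_mul _)

lemma Rapid.opL_synth (hh : Rapid h) (μ ψ : ℝ) :
    opL μ ψ (synth h) = synth fun v => opSymbol μ ψ v * h v := by
  have hv := hh.derivSymbol_mul (vert n)
  have hs : ∀ i : Fin n, Rapid fun v => derivSymbol (horiz i) v * (derivSymbol (horiz i) v * h v) :=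
    fun i => (hh.derivSymbol_mul (horiz i)).derivSymbol_mul (horiz i)
  rw [opSymbol_mul_eq, synth_add (((hh.const_mul _).add (hv.const_mul _)).add
    (hv.derivSymbol_mul _)) ((Rapid.sum _ hs).const_mul _),
    synth_add ((hh.const_mul _).add (hv.const_mul _)) (hv.derivSymbol_mul _),
    synth_add (hh.const_mul _) (hv.const_mul _)]
  simp only [synth_const_mul, synth_sum _ hs]
  rw [opL_eq μ ψ hh.contDiff_synth]
  simp only [hh.dirDeriv_synth, Rapid.dirDeriv_synth (hh.derivSymbol_mul _)]
  ext p
  ring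

lemma Rapid.opL_iterate_synth (hh : Rapid h) (μ ψ : ℝ) (j : ℕ) :
    Rapid (fun v => opSymbol μ ψ v ^ j * h v) ∧
      (opL μ ψ)^[j] (synth h) = synth fun v => opSymbol μ ψ v ^ j * h v := by
  induction j with
  | zero => simpa using hh
  | succ j ih =>
    have e : (fun v => opSymbol μ ψ v ^ (j + 1) * h v) =
        fun v => opSymbol μ ψ v * (opSymbol μ ψ v ^ j * h v) := by
      ext v
      ring
    rw [Function.iterate_succ_apply', ih.2, e]
    exact ⟨ih.1.opSymbol_mul μ ψ, ih.1.opL_synth μ ψ⟩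

/-- Smooth compactly supported functions are superpositions of plane waves. -/
lemma exists_rapid_synth {f : Space n → ℂ} (hf : ContDiff ℝ ∞ f) (hc : HasCompactSupport f) :
    ∃ h : Freq n → ℂ, Rapid h ∧ f = synth h := by
  -- `Space n` carries the maximum norm, while Fourier inversion needs an inner product; hence the
  -- transport to `Freq n`. The density is the inverse Fourier transform of the transported f.
  set e := WithLp.prodContinuousLinearEquiv 2 ℝ (EuclideanSpace ℝ (Fin n)) ℝ
  have hc' : HasCompactSupport (f ∘ e) := hc.comp_homeomorph e.toHomeomorph
  have hf' : ContDiff ℝ ∞ (f ∘ e) := hf.comp e.contDiff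
  set φ : SchwartzMap (Freq n) ℂ := hc'.toSchwartzMap hf'
  set H : SchwartzMap (Freq n) ℂ := FourierTransformInv.fourierInv φ
  refine ⟨H, ⟨H.continuous.aestronglyMeasurable, fun N => H.integrable_pow_mul volume N⟩, ?_⟩
  have h1 : FourierTransform.fourier H = φ := FourierTransform.fourier_fourierInv_eq φ
  ext p
  have h2 : φ (e.symm p) = f p := by
    change f (e (e.symm p)) = f p
    simp
  rw [← h2, ← h1, SchwartzMap.fourier_coe, Real.fourier_eq, synth, VectorFourier.fourierIntegral]
  rfl

end Synthesis

/-! ### Averages over measures as multipliers. -/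

section Averages

variable {n : ℕ}

/-- The average of the translates of `f` with respect to `ν`. -/
def avg (ν : Measure (Space n)) (f : Space n → ℂ) (p : Space n) : ℂ := ∫ q, f (p + q) ∂ν

/-- The multiplier of `avg ν`. -/
def avgSymbol (ν : Measure (Space n)) (v : Freq n) : ℂ :=
  ∫ q, (Real.fourierChar (-(pairing n v q)) : ℂ) ∂ν

/-- Fubini; finiteness of ν bounds the symbol, so the new density is still rapid. -/
lemma Rapid.avg_synth {h : Freq n → ℂ} (hh : Rapid h) (ν : Measure (Space n)) [IsFiniteMeasure ν] :
    Rapid (fun v => avgSymbol ν v * h v) ∧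
      avg ν (synth h) = synth fun v => avgSymbol ν v * h v := by
  have hcont : Continuous fun r : Freq n × Space n =>
      (Real.fourierChar (-(pairing n r.1 r.2)) : ℂ) := by
    have := (pairing n).continuous₂
    have h2 : Continuous fun r : Freq n × Space n => pairing n r.1 r.2 := this
    fun_prop
  constructor
  · refine hh.mul_of_bound ?_ (ν.real univ) 0 fun v => ?_
    · exact (hcont.stronglyMeasurable.integral_prod_right (ν := ν)).aestronglyMeasurable
    · rw [avgSymbol, pow_zero, mul_one]
      refine (norm_integral_le_of_norm_le_const (C := 1)
        (.of_forall fun q => (norm_char _).le)).trans_eq (one_mul _)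
  · ext p
    simp only [avg, synth_apply]
    rw [integral_integral_swap]
    · refine integral_congr_ae (.of_forall fun v => ?_)
      simp only
      rw [avgSymbol, ← integral_mul_const, ← integral_const_mul]
      refine integral_congr_ae (.of_forall fun q => ?_)
      simp only [map_add, neg_add, AddChar.map_add_eq_mul, Circle.coe_mul]
      ring
    · have h1 : Integrable (fun r : Space n × Freq n => h r.2) (ν.prod volume) :=
        hh.integrable.comp_snd ν
      have h2 : Continuous fun r : Space n × Freq n => (r.2, p + r.1) := by fun_prop
      exact h1.bdd_mul (c := 1) (hcont.comp h2).aestronglyMeasurable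
        (.of_forall fun r => (norm_char _).le)

end Averages

/-! ### The attenuated measure on the cone. -/

section ConeMeasure

variable {n : ℕ}

/-- The parametrization of the cone with vertex at the origin. -/
def coneMap {n : ℕ} (t : ℝ) (q : Sph n × ℝ) : Space n :=
  ((q.2 * t) • (q.1 : EuclideanSpace ℝ (Fin n)), q.2)

lemma continuous_coneMap (t : ℝ) : Continuous (coneMap t : Sph n × ℝ → Space n) := by
  unfold coneMap
  fun_prop

/-- The measure with density `exp (-a z) z ^ m` with respect to `dz dS` on the cone of slope `t`. -/
def coneMeasure (n : ℕ) (a t : ℝ) (m : ℕ) : Measure (Space n) :=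
  ((polarMeasure n).withDensity fun q => ENNReal.ofReal (Real.exp (-a * q.2) * q.2 ^ m)).map
    (coneMap t)

lemma integrable_coneMeasure_iff {a t : ℝ} {m : ℕ} {E : Type*} [NormedAddCommGroup E]
    [NormedSpace ℝ E] {F : Space n → E} (hF : AEStronglyMeasurable F (coneMeasure n a t m)) :
    Integrable F (coneMeasure n a t m) ↔
      Integrable (fun q => (Real.exp (-a * q.2) * q.2 ^ m) • F (coneMap t q)) (polarMeasure n) := by
  rw [coneMeasure, integrable_map_measure hF (continuous_coneMap t).aemeasurable,
    integrable_withDensity_iff_integrable_smul' (by fun_prop)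
      (.of_forall fun _ => ENNReal.ofReal_lt_top)]
  refine integrable_congr ?_
  filter_upwards [ae_polarMeasure_pos n] with q hq
  rw [ENNReal.toReal_ofReal (by positivity)]
  rfl

lemma integral_coneMeasure {a t : ℝ} {m : ℕ} {E : Type*} [NormedAddCommGroup E]
    [NormedSpace ℝ E] {F : Space n → E} (hF : AEStronglyMeasurable F (coneMeasure n a t m)) :
    ∫ q, F q ∂coneMeasure n a t m =
      ∫ q, (Real.exp (-a * q.2) * q.2 ^ m) • F (coneMap t q) ∂polarMeasure n := by
  rw [coneMeasure, integral_map (continuous_coneMap t).aemeasurable hF,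
    integral_withDensity_eq_integral_toReal_smul (by fun_prop)
      (.of_forall fun _ => ENNReal.ofReal_lt_top)]
  refine integral_congr_ae ?_
  filter_upwards [ae_polarMeasure_pos n] with q hq
  rw [ENNReal.toReal_ofReal (by positivity)]

lemma norm_coneMap_le (t : ℝ) {q : Sph n × ℝ} (hq : 0 < q.2) :
    ‖coneMap t q‖ ≤ (1 + |t|) * q.2 := by
  rw [coneMap, Prod.norm_def, norm_smul, norm_eq_of_mem_sphere, mul_one, norm_mul,
    Real.norm_of_nonneg hq.le, Real.norm_eq_abs]
  have := mul_nonneg hq.le (abs_nonneg t)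
  exact max_le (by linarith) (by linarith)

/-- Attenuation beats every polynomial. This is what makes averaging compatible with temperedness
and polynomial decay. -/
lemma integrable_moment_coneMeasure {a : ℝ} (ha : 0 < a) (t : ℝ) (m N : ℕ) :
    Integrable (fun q => (1 + ‖q‖) ^ N) (coneMeasure n a t m) := by
  rw [integrable_coneMeasure_iff (Continuous.aestronglyMeasurable (by fun_prop))]
  refine ((((integrable_polar_weight n m ha).add (integrable_polar_weight n (m + N) ha)).const_mul
    ((1 + |t|) ^ N * 2 ^ (N - 1)))).mono' (Continuous.aestronglyMeasurable ?_) ?_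
  · have := continuous_coneMap (n := n) t
    fun_prop
  · filter_upwards [ae_polarMeasure_pos n] with q hq
    rw [Real.norm_of_nonneg (by positivity), smul_eq_mul]
    have h1 : (1 + ‖coneMap t q‖) ^ N ≤ (1 + |t|) ^ N * (2 ^ (N - 1) * (1 + q.2 ^ N)) := by
      calc (1 + ‖coneMap t q‖) ^ N ≤ ((1 + |t|) * (1 + q.2)) ^ N := by
            gcongr
            have := norm_coneMap_le t hq
            have := abs_nonneg t
            nlinarith
        _ ≤ _ := by
            rw [mul_pow]
            gcongr
            simpa using add_pow_le zero_le_one hq.le N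
    have h2 : 0 ≤ Real.exp (-a * q.2) * q.2 ^ m := by positivity
    refine (mul_le_mul_of_nonneg_left h1 h2).trans_eq ?_
    simp only [Pi.add_apply, pow_add, neg_mul]
    ring

lemma isFiniteMeasure_coneMeasure {a : ℝ} (ha : 0 < a) (t : ℝ) (m : ℕ) :
    IsFiniteMeasure (coneMeasure n a t m) := by
  have h := integrable_moment_coneMeasure (n := n) ha t m 0
  simp only [pow_zero] at h
  exact (integrable_const_iff_isFiniteMeasure one_ne_zero).1 h

lemma avgSymbol_coneMeasure {a : ℝ} (t : ℝ) (m : ℕ) (v : Freq n) :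
    avgSymbol (coneMeasure n a t m) v =
      waveMoment m (a + 2 * Real.pi * Complex.I * v.snd) (-(2 * Real.pi * t) • v.fst) := by
  rw [avgSymbol, integral_coneMeasure, waveMoment]
  · refine integral_congr_ae (.of_forall fun q => ?_)
    simp only [Real.fourierChar_apply, polarWave, pairing_apply, coneMap, inner_smul_right,
      inner_smul_left, RCLike.conj_to_real, Complex.real_smul]
    push_cast
    rw [mul_comm (Complex.exp _), mul_assoc, ← Complex.exp_add]
    congr 2
    ring
  · refine Continuous.aestronglyMeasurable ?_
    have h2 : Continuous fun q : Space n => pairing n v q := by fun_prop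
    fun_prop

end ConeMeasure

/-! ### Symbol identities and inversion formulas. -/

section Symbols

variable {m : ℕ} {μ ψ : ℝ}

/-- The value of the square of the auxiliary symbol, up to a power of `opSymbol`. -/
def symbolConst (m : ℕ) : ℂ := ((surf (m + 2)).real univ * (m.factorial : ℂ)) ^ 2

lemma symbolConst_ne_zero (m : ℕ) : symbolConst m ≠ 0 := by
  have h : (volume : Measure (EuclideanSpace ℝ (Fin (m + 2)))).real (Metric.ball 0 1) ≠ 0 :=
    (ENNReal.toReal_pos (Metric.measure_ball_pos _ _ one_pos).ne' measure_ball_lt_top.ne).ne'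
  have h1 : (m : ℂ) + 2 ≠ 0 := by norm_cast
  have h2 := m.factorial_ne_zero
  simp [symbolConst, h, h1, h2]

/-- The measure underlying the auxiliary transform (`j = n - 2`) and the conical Radon transform
(`j = n - 1`). -/
abbrev coneNu (n : ℕ) (μ ψ : ℝ) (j : ℕ) : Measure (Space n) :=
  coneMeasure n (μ / Real.cos ψ) (Real.tan ψ) j

lemma opSymbol_eq_sq_add_sq {n : ℕ} (v : Freq n) :
    opSymbol μ ψ v = ((μ / Real.cos ψ : ℝ) + 2 * Real.pi * Complex.I * v.snd) ^ 2 +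
      (‖-(2 * Real.pi * Real.tan ψ) • v.fst‖ : ℂ) ^ 2 := by
  rw [opSymbol, norm_smul, Real.norm_eq_abs, abs_neg]
  congr 1
  rw [← Complex.ofReal_pow, ← Complex.ofReal_pow, mul_pow _ ‖v.fst‖, mul_pow _ ‖v.fst‖, sq_abs]

lemma re_pos_of_pos {a : ℝ} (ha : 0 < a) (x : ℝ) :
    0 < ((a : ℂ) + 2 * Real.pi * Complex.I * x).re := by
  simpa using ha

/-- Two auxiliary averages invert L ^ (n - 1) up to a constant, n = m + 2. -/
lemma avgSymbol_sq (ha : 0 < μ / Real.cos ψ) (v : Freq (m + 2)) :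
    avgSymbol (coneNu (m + 2) μ ψ m) v ^ 2 * opSymbol μ ψ v ^ (m + 1) = symbolConst m := by
  rw [avgSymbol_coneMeasure, opSymbol_eq_sq_add_sq]
  exact waveMoment_sq (re_pos_of_pos ha _) _

/-- On the symbol side, L turns the conical transform into a multiple of a - ∂_z applied to the
auxiliary one. -/
lemma avgSymbol_succ (ha : 0 < μ / Real.cos ψ) (v : Freq (m + 2)) :
    opSymbol μ ψ v * avgSymbol (coneNu (m + 2) μ ψ (m + 1)) v =
      (m + 1) * ((μ / Real.cos ψ : ℝ) + 2 * Real.pi * Complex.I * v.snd) *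
        avgSymbol (coneNu (m + 2) μ ψ m) v := by
  rw [avgSymbol_coneMeasure, avgSymbol_coneMeasure, opSymbol_eq_sq_add_sq]
  exact waveMoment_succ (re_pos_of_pos ha _) _

/-- The reconstruction formula for the conical Radon transform. -/
lemma opL_iterate_avg_avg (ha : 0 < μ / Real.cos ψ) {f : Space (m + 2) → ℂ}
    (hf : ContDiff ℝ ∞ f) (hc : HasCompactSupport f) :
    (opL μ ψ)^[m + 2] (avg (coneNu (m + 2) μ ψ m) (avg (coneNu (m + 2) μ ψ (m + 1)) f)) =
      fun p => (m + 1) * symbolConst m *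
        ((μ / Real.cos ψ : ℝ) * f p - dirDeriv (vert (m + 2)) f p) := by
  have := isFiniteMeasure_coneMeasure (n := m + 2) ha (Real.tan ψ) m
  have := isFiniteMeasure_coneMeasure (n := m + 2) ha (Real.tan ψ) (m + 1)
  obtain ⟨h, hh, rfl⟩ := exists_rapid_synth hf hc
  obtain ⟨r1, e1⟩ := hh.avg_synth (coneNu (m + 2) μ ψ (m + 1))
  obtain ⟨r2, e2⟩ := r1.avg_synth (coneNu (m + 2) μ ψ m)
  rw [e1, e2, (r2.opL_iterate_synth μ ψ (m + 2)).2, hh.dirDeriv_synth]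
  -- One factor of P is spent on Ĉ, the other m + 1 on Â².
  have e3 : (fun v => opSymbol μ ψ v ^ (m + 2) * (avgSymbol (coneNu (m + 2) μ ψ m) v *
      (avgSymbol (coneNu (m + 2) μ ψ (m + 1)) v * h v))) = fun v => ((m + 1) * symbolConst m) *
        (((μ / Real.cos ψ : ℝ) : ℂ) * h v + (-1) * (derivSymbol (vert (m + 2)) v * h v)) := by
    ext v
    have h1 := avgSymbol_sq ha v
    have h2 := avgSymbol_succ ha v
    have h3 : derivSymbol (vert (m + 2)) v = -(2 * Real.pi * Complex.I) * v.snd := by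
      simp [derivSymbol, pairing_apply, vert]
    rw [h3, ← h1, pow_succ]
    linear_combination (opSymbol μ ψ v ^ (m + 1) * avgSymbol (coneNu (m + 2) μ ψ m) v * h v) * h2
  rw [e3, synth_const_mul, synth_add (hh.const_mul _) ((hh.derivSymbol_mul _).const_mul _),
    synth_const_mul, synth_const_mul]
  ext p
  ring

/-- Inversion of the auxiliary transform. -/
lemma avg_iterate_opL_iterate (ha : 0 < μ / Real.cos ψ) {f : Space (m + 2) → ℂ}
    (hf : ContDiff ℝ ∞ f) (hc : HasCompactSupport f) :
    (avg (coneNu (m + 2) μ ψ m))^[4] ((opL μ ψ)^[m + 2] ((opL μ ψ)^[m] f)) =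
      fun p => symbolConst m ^ 2 * f p := by
  have := isFiniteMeasure_coneMeasure (n := m + 2) ha (Real.tan ψ) m
  obtain ⟨h, hh, rfl⟩ := exists_rapid_synth hf hc
  obtain ⟨r0, e0⟩ := hh.opL_iterate_synth μ ψ (m + 2 + m)
  rw [← Function.iterate_add_apply, e0]
  obtain ⟨r1, e1⟩ := r0.avg_synth (coneNu (m + 2) μ ψ m)
  obtain ⟨r2, e2⟩ := r1.avg_synth (coneNu (m + 2) μ ψ m)
  obtain ⟨r3, e3⟩ := r2.avg_synth (coneNu (m + 2) μ ψ m)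
  obtain ⟨r4, e4⟩ := r3.avg_synth (coneNu (m + 2) μ ψ m)
  simp only [Function.iterate_succ_apply, Function.iterate_zero, id]
  rw [e1, e2, e3, e4, ← synth_const_mul]
  congr 1
  ext v
  -- The n = m + 2 powers of L exceed the m + 1 that Â² absorbs; m more make 2 (m + 1), absorbed by
  -- Â⁴.
  rw [← avgSymbol_sq ha v]
  ring

lemma contDiff_avg_coneMeasure (ha : 0 < μ / Real.cos ψ) {n : ℕ} (i j : ℕ) {f : Space n → ℂ}
    (hf : ContDiff ℝ ∞ f) (hc : HasCompactSupport f) :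
    ContDiff ℝ ∞ (avg (coneNu n μ ψ j) f) ∧
      ContDiff ℝ ∞ (avg (coneNu n μ ψ i) (avg (coneNu n μ ψ j) f)) ∧
      ∃ B, ∀ p, ‖avg (coneNu n μ ψ j) f p‖ ≤ B := by
  have := isFiniteMeasure_coneMeasure (n := n) ha (Real.tan ψ) i
  have := isFiniteMeasure_coneMeasure (n := n) ha (Real.tan ψ) j
  obtain ⟨h, hh, rfl⟩ := exists_rapid_synth hf hc
  obtain ⟨r1, e1⟩ := hh.avg_synth (coneNu n μ ψ j)
  obtain ⟨r2, e2⟩ := r1.avg_synth (coneNu n μ ψ i)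
  rw [e1, e2]
  exact ⟨r1.contDiff_synth, r2.contDiff_synth, _, fun p =>
    VectorFourier.norm_fourierIntegral_le_integral_norm _ _ _ _ p⟩

end Symbols

/-! ### The transforms as averages; linearity of L. -/

section Transforms

variable {μ ψ : ℝ} {m : ℕ}

lemma integrable_avg {n : ℕ} {ν : Measure (Space n)} [IsFiniteMeasure ν] {f : Space n → ℂ}
    (hf : Continuous f) {B : ℝ} (hB : ∀ p, ‖f p‖ ≤ B) (p : Space n) :
    Integrable (fun q => f (p + q)) ν :=
  (integrable_const B).mono' (Continuous.aestronglyMeasurable (by fun_prop))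
    (.of_forall fun q => hB _)

/-- The common normalizing constant of the two transforms. -/
def normConst (m : ℕ) (ψ : ℝ) : ℂ := (Real.tan ψ ^ (m + 1) / Real.cos ψ : ℝ)

lemma coneTransform_eq {f : Space (m + 2) → ℂ} (hf : Continuous f)
    (hi : ∀ p, Integrable (fun q => f (p + q)) (coneNu (m + 2) μ ψ (m + 1))) :
    coneTransform μ ψ f = fun p => normConst m ψ * avg (coneNu (m + 2) μ ψ (m + 1)) f p := by
  ext p
  have hm : AEStronglyMeasurable (fun q => f (p + q)) (coneNu (m + 2) μ ψ (m + 1)) :=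
    Continuous.aestronglyMeasurable (by fun_prop)
  rw [avg, integral_coneMeasure hm, integral_prod _ ((integrable_coneMeasure_iff hm).1 (hi p))]
  rw [coneTransform, Complex.real_smul]
  rfl

lemma auxConverges_iff {g : Space (m + 2) → ℂ} (hg : Continuous g) :
    AuxConverges μ ψ g ↔ ∀ p, Integrable (fun q => g (p + q)) (coneNu (m + 2) μ ψ m) := by
  refine forall_congr' fun p => ?_
  have hm : AEStronglyMeasurable (fun q => g (p + q)) (coneNu (m + 2) μ ψ m) :=
    Continuous.aestronglyMeasurable (by fun_prop)
  rw [integrable_coneMeasure_iff hm]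
  rfl

/-- Absolute convergence turns the iterated integral into one over the product, hence over the cone
measure. -/
lemma auxTransform_eq {g : Space (m + 2) → ℂ} (hg : Continuous g) (hc : AuxConverges μ ψ g) :
    auxTransform μ ψ g = fun p => normConst m ψ * avg (coneNu (m + 2) μ ψ m) g p := by
  ext p
  have hm : AEStronglyMeasurable (fun q => g (p + q)) (coneNu (m + 2) μ ψ m) :=
    Continuous.aestronglyMeasurable (by fun_prop)
  rw [avg, integral_coneMeasure hm, integral_prod _
    ((integrable_coneMeasure_iff hm).1 ((auxConverges_iff hg).1 hc p))]
  rw [auxTransform, Complex.real_smul]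
  rfl

lemma opL_const_mul {n : ℕ} {F : Space n → ℂ} (hF : ContDiff ℝ ∞ F) (c : ℂ) :
    opL μ ψ (fun p => c * F p) = fun p => c * opL μ ψ F p := by
  have hd : ∀ (v : Space n) {F : Space n → ℂ}, ContDiff ℝ ∞ F →
      dirDeriv v (fun p => c * F p) = fun p => c * dirDeriv v F p := by
    intro v F hF
    ext p
    rw [dirDeriv, fderiv_const_mul ((hF.differentiable (by simp)) p)]
    rfl
  rw [opL_eq μ ψ hF, opL_eq μ ψ (contDiff_const.mul hF)]
  simp only [hd _ hF, hd _ (contDiff_dirDeriv hF _), ← Finset.mul_sum]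
  ext p
  ring

lemma opL_sub {n : ℕ} {F G : Space n → ℂ} (hF : ContDiff ℝ ∞ F) (hG : ContDiff ℝ ∞ G) :
    opL μ ψ (fun p => F p - G p) = fun p => opL μ ψ F p - opL μ ψ G p := by
  have hd : ∀ (v : Space n) {F G : Space n → ℂ}, ContDiff ℝ ∞ F → ContDiff ℝ ∞ G →
      dirDeriv v (fun p => F p - G p) = fun p => dirDeriv v F p - dirDeriv v G p := by
    intro v F G hF hG
    ext p
    rw [dirDeriv, fderiv_fun_sub ((hF.differentiable (by simp)) p)
      ((hG.differentiable (by simp)) p)]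
    rfl
  rw [opL_eq μ ψ hF, opL_eq μ ψ hG, opL_eq μ ψ (hF.sub hG)]
  simp only [hd _ hF hG, hd _ (contDiff_dirDeriv hF _) (contDiff_dirDeriv hG _),
    Finset.sum_sub_distrib]
  ext p
  ring

lemma opL_iterate_const_mul {n : ℕ} {F : Space n → ℂ} (hF : ContDiff ℝ ∞ F) (c : ℂ) (j : ℕ) :
    (opL μ ψ)^[j] (fun p => c * F p) = fun p => c * (opL μ ψ)^[j] F p := by
  induction j with
  | zero => rfl
  | succ j ih =>
    simp only [Function.iterate_succ_apply', ih]
    exact opL_const_mul (contDiff_opL_iterate μ ψ hF j) c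

lemma opL_iterate_sub {n : ℕ} {F G : Space n → ℂ} (hF : ContDiff ℝ ∞ F) (hG : ContDiff ℝ ∞ G)
    (j : ℕ) : (opL μ ψ)^[j] (fun p => F p - G p) =
      fun p => (opL μ ψ)^[j] F p - (opL μ ψ)^[j] G p := by
  induction j with
  | zero => rfl
  | succ j ih =>
    simp only [Function.iterate_succ_apply', ih]
    exact opL_sub (contDiff_opL_iterate μ ψ hF j) (contDiff_opL_iterate μ ψ hG j)

instance isAddHaarMeasure_volume_space (n : ℕ) : (volume : Measure (Space n)).IsAddHaarMeasure := by
  rw [Measure.volume_eq_prod]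
  infer_instance

lemma isTempered_of_bounded {n : ℕ} {g : Space n → ℂ} (hg : Continuous g) {B : ℝ}
    (hB : ∀ p, ‖g p‖ ≤ B) : IsTempered g := by
  set d := Module.finrank ℝ (Space n)
  -- Any exponent above the dimension makes the weight integrable.
  refine ⟨d + 1, ?_⟩
  have h := integrable_one_add_norm (E := Space n) (μ := volume) (r := ((d + 1 : ℕ) : ℝ))
    (by push_cast; exact lt_add_one _)
  refine (h.const_mul B).mono' (Continuous.aestronglyMeasurable ?_) (.of_forall fun p => ?_)
  · refine Continuous.smul (f := fun p => ((1 + ‖p‖) ^ (d + 1))⁻¹)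
      (Continuous.inv₀ (by fun_prop) fun p => ?_) hg
    positivity
  · rw [norm_smul, Real.norm_of_nonneg (by positivity), Real.rpow_neg (by positivity),
      Real.rpow_natCast, mul_comm]
    have := hB p
    gcongr

end Transforms

/-! ### Moving L across a convolution. -/

section IntegrationByParts

variable {n : ℕ}

lemma hasCompactSupport_comp_sub_left {φ : Space n → ℂ} (hφ : HasCompactSupport φ) (r : Space n) :
    HasCompactSupport fun p => φ (r - p) :=
  hφ.comp_homeomorph (Homeomorph.subLeft r)

lemma integrable_mul_comp_sub {H φ : Space n → ℂ} (hH : Continuous H) (hφ : Continuous φ)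
    (hc : HasCompactSupport φ) (r : Space n) : Integrable fun p => H p * φ (r - p) :=
  Continuous.integrable_of_hasCompactSupport (by fun_prop)
    (hasCompactSupport_comp_sub_left hc r).mul_left

/-- The reflection p ↦ r - p cancels the sign of integration by parts, so L passes to the other
factor unchanged, without a transpose. -/
lemma integral_dirDeriv_mul {H φ : Space n → ℂ} (hH : ContDiff ℝ ∞ H) (hφ : ContDiff ℝ ∞ φ)
    (hc : HasCompactSupport φ) (v r : Space n) :
    ∫ p, dirDeriv v H p * φ (r - p) = ∫ p, H p * dirDeriv v φ (r - p) := by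
  have hd : ∀ p, fderiv ℝ (fun p => φ (r - p)) p v = -dirDeriv v φ (r - p) := by
    intro p
    have h1 := ((hφ.differentiable (by simp)) (r - p)).hasFDerivAt.comp p
      ((hasFDerivAt_id p).const_sub r)
    have h2 : HasFDerivAt (fun p => φ (r - p)) _ p := h1
    rw [h2.fderiv]
    simp [dirDeriv]
  have h1 : Integrable fun p => H p * dirDeriv v φ (r - p) :=
    integrable_mul_comp_sub hH.continuous (contDiff_dirDeriv hφ v).continuous
      (hasCompactSupport_dirDeriv hc v) r
  have hdiff : Differentiable ℝ fun p => φ (r - p) :=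
    (hφ.differentiable (by simp)).comp (by fun_prop)
  have key := integral_mul_fderiv_eq_neg_fderiv_mul_of_integrable (μ := volume) (f := H)
    (g := fun p => φ (r - p)) (v := v)
    (integrable_mul_comp_sub (contDiff_dirDeriv hH v).continuous hφ.continuous hc r)
    (by simpa only [hd, mul_neg] using! h1.neg)
    (integrable_mul_comp_sub hH.continuous hφ.continuous hc r)
    (fun x _ => (hH.differentiable (by simp)) x) (fun x _ => hdiff x)
  simp only [hd, mul_neg, integral_neg, neg_inj] at key
  exact key.symm

lemma integral_sub_add_sub {f₀ f₁ f₂ f₃ : Space n → ℂ} (h₀ : Integrable f₀) (h₁ : Integrable f₁)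
    (h₂ : Integrable f₂) (h₃ : Integrable f₃) :
    ∫ p, (f₀ p - f₁ p + f₂ p - f₃ p) =
      (∫ p, f₀ p) - (∫ p, f₁ p) + (∫ p, f₂ p) - ∫ p, f₃ p := by
  have h01 : Integrable fun p => f₀ p - f₁ p := h₀.sub h₁
  have h012 : Integrable fun p => f₀ p - f₁ p + f₂ p := h01.add h₂
  rw [integral_sub h012 h₃, integral_add h01 h₂, integral_sub h₀ h₁]

lemma integral_opL_mul {μ ψ : ℝ} {H φ : Space n → ℂ} (hH : ContDiff ℝ ∞ H) (hφ : ContDiff ℝ ∞ φ)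
    (hc : HasCompactSupport φ) (r : Space n) :
    ∫ p, opL μ ψ H p * φ (r - p) = ∫ p, H p * opL μ ψ φ (r - p) := by
  have hH1 := fun v => contDiff_dirDeriv hH v
  have hH2 := fun v => contDiff_dirDeriv (hH1 v) v
  have hφ1 := fun v => contDiff_dirDeriv hφ v
  have hφ2 := fun v => contDiff_dirDeriv (hφ1 v) v
  have hc1 := fun v => hasCompactSupport_dirDeriv hc v
  have hc2 := fun v => hasCompactSupport_dirDeriv (hc1 v) v
  have i0 := integrable_mul_comp_sub hH.continuous hφ.continuous hc r
  have i1 := fun v => integrable_mul_comp_sub (hH1 v).continuous hφ.continuous hc r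
  have i2 := fun v => integrable_mul_comp_sub (hH2 v).continuous hφ.continuous hc r
  have j1 := fun v => integrable_mul_comp_sub hH.continuous (hφ1 v).continuous (hc1 v) r
  have j2 := fun v => integrable_mul_comp_sub hH.continuous (hφ2 v).continuous (hc2 v) r
  have e1 := fun v => integral_dirDeriv_mul hH hφ hc v r
  have e2 : ∀ v, ∫ p, dirDeriv v (dirDeriv v H) p * φ (r - p) =
      ∫ p, H p * dirDeriv v (dirDeriv v φ) (r - p) := fun v => by
    rw [integral_dirDeriv_mul (hH1 v) hφ hc, integral_dirDeriv_mul hH (hφ1 v) (hc1 v)]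
  rw [opL_eq μ ψ hH, opL_eq μ ψ hφ]
  simp only [add_mul, sub_mul, mul_add, mul_sub, Finset.sum_mul, Finset.mul_sum, mul_assoc,
    mul_left_comm (H _)]
  have is1 : ∀ c : ℂ, Integrable fun p => ∑ i : Fin n, c * (dirDeriv (horiz i) (dirDeriv (horiz i) H) p *
      φ (r - p)) := fun c => integrable_finsetSum _ fun i _ => (i2 (horiz i)).const_mul c
  have is2 : ∀ c : ℂ, Integrable fun p => ∑ i : Fin n, c * (H p *
      dirDeriv (horiz i) (dirDeriv (horiz i) φ) (r - p)) :=
    fun c => integrable_finsetSum _ fun i _ => (j2 (horiz i)).const_mul c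
  rw [integral_sub_add_sub (i0.const_mul _) ((i1 _).const_mul _) (i2 _) (is1 _),
    integral_sub_add_sub (i0.const_mul _) ((j1 _).const_mul _) (j2 _) (is2 _),
    integral_finsetSum _ fun i _ => (i2 (horiz i)).const_mul _,
    integral_finsetSum _ fun i _ => (j2 (horiz i)).const_mul _]
  simp only [integral_const_mul, e1, e2]

lemma integral_opL_iterate_mul {μ ψ : ℝ} {H φ : Space n → ℂ} (hH : ContDiff ℝ ∞ H)
    (hφ : ContDiff ℝ ∞ φ) (hc : HasCompactSupport φ) (r : Space n) (j : ℕ) :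
    ∫ p, (opL μ ψ)^[j] H p * φ (r - p) = ∫ p, H p * (opL μ ψ)^[j] φ (r - p) := by
  induction j generalizing φ with
  | zero => rfl
  | succ j ih =>
    rw [Function.iterate_succ_apply', Function.iterate_succ_apply,
      integral_opL_mul (contDiff_opL_iterate μ ψ hH j) hφ hc,
      ih (contDiff_opL μ ψ hφ) (hasCompactSupport_opL μ ψ hφ hc)]

end IntegrationByParts

/-! ### Moving averages across a convolution. -/

section Duality

variable {n N : ℕ} {ν : Measure (Space n)} {G θ : Space n → ℂ} {B : ℝ}

/-- Peetre's inequality. -/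
lemma one_add_norm_pow_inv_le (p q : Space n) (N : ℕ) :
    ((1 + ‖q‖) ^ N)⁻¹ ≤ ((1 + ‖p‖) ^ N)⁻¹ * (1 + ‖p - q‖) ^ N := by
  have h : 1 + ‖p‖ ≤ (1 + ‖q‖) * (1 + ‖p - q‖) := by
    have h1 : ‖p‖ ≤ ‖q‖ + ‖p - q‖ := by simpa using norm_add_le q (p - q)
    nlinarith [norm_nonneg q, norm_nonneg (p - q)]
  have h2 := pow_le_pow_left₀ (by positivity) h N
  rw [mul_pow] at h2
  have h3 : 0 < (1 + ‖q‖) ^ N := by positivity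
  have h4 : 0 < (1 + ‖p‖) ^ N := by positivity
  rw [← sub_nonneg]
  have : ((1 + ‖p‖) ^ N)⁻¹ * (1 + ‖p - q‖) ^ N - ((1 + ‖q‖) ^ N)⁻¹ =
      ((1 + ‖q‖) ^ N * (1 + ‖p - q‖) ^ N - (1 + ‖p‖) ^ N) /
        ((1 + ‖p‖) ^ N * (1 + ‖q‖) ^ N) := by
    field_simp
  rw [this]
  exact div_nonneg (by linarith) (by positivity)

/-- Peetre's inequality splits the decay of θ at r - p + q into the weight that makes G integrable
in p and a factor (1 + ‖q‖) ^ N that ν integrates. -/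
lemma integrable_convolution_kernel [SFinite ν] (hG : Continuous G)
    (hGi : Integrable fun p => ((1 + ‖p‖) ^ N)⁻¹ • G p) (hθ : Continuous θ)
    (hB : ∀ p, ‖θ p‖ ≤ B * ((1 + ‖p‖) ^ N)⁻¹) (hν : Integrable (fun q => (1 + ‖q‖) ^ N) ν)
    (r : Space n) :
    Integrable (fun s : Space n × Space n => G s.1 * θ (r - s.1 + s.2)) (volume.prod ν) := by
  have hB0 : 0 ≤ B := by
    have := (norm_nonneg _).trans (hB 0)
    simpa using this
  refine ((hGi.norm.mul_prod hν).const_mul (B * (1 + ‖r‖) ^ N)).mono'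
    (Continuous.aestronglyMeasurable (by fun_prop)) (.of_forall fun s => ?_)
  obtain ⟨p, q⟩ := s
  simp only [norm_mul, norm_smul, norm_inv, norm_pow]
  rw [Real.norm_of_nonneg (by positivity : 0 ≤ 1 + ‖p‖)]
  have h1 : ((1 + ‖r - p + q‖) ^ N)⁻¹ ≤ ((1 + ‖p‖) ^ N)⁻¹ * ((1 + ‖r‖) * (1 + ‖q‖)) ^ N := by
    have h2 := one_add_norm_pow_inv_le (-p) (r - p + q) N
    rw [norm_neg] at h2
    refine h2.trans ?_
    gcongr
    have h3 : ‖-p - (r - p + q)‖ ≤ ‖r‖ + ‖q‖ := by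
      have : -p - (r - p + q) = -(r + q) := by abel
      rw [this, norm_neg]
      exact norm_add_le _ _
    nlinarith [norm_nonneg r, norm_nonneg q]
  calc ‖G p‖ * ‖θ (r - p + q)‖ ≤ ‖G p‖ * (B * (((1 + ‖p‖) ^ N)⁻¹ * ((1 + ‖r‖) * (1 + ‖q‖)) ^ N)) := by
        gcongr
        exact (hB _).trans (by gcongr)
    _ = _ := by
        rw [mul_pow]
        ring

lemma integral_mul_avg [SFinite ν] (hG : Continuous G)
    (hGi : Integrable fun p => ((1 + ‖p‖) ^ N)⁻¹ • G p) (hθ : Continuous θ)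
    (hB : ∀ p, ‖θ p‖ ≤ B * ((1 + ‖p‖) ^ N)⁻¹) (hν : Integrable (fun q => (1 + ‖q‖) ^ N) ν)
    (r : Space n) :
    ∫ p, G p * avg ν θ (r - p) = ∫ q, (∫ p, G p * θ (r + q - p)) ∂ν := by
  simp only [avg, ← integral_const_mul]
  rw [integral_integral_swap (integrable_convolution_kernel hG hGi hθ hB hν r)]
  simp only [sub_add_eq_add_sub]

/-- Substituting p + q for p moves the shift from G to θ; in convolution form the average is its own
transpose. -/
lemma integral_avg_mul [SFinite ν] (hG : Continuous G)
    (hGi : Integrable fun p => ((1 + ‖p‖) ^ N)⁻¹ • G p) (hθ : Continuous θ)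
    (hB : ∀ p, ‖θ p‖ ≤ B * ((1 + ‖p‖) ^ N)⁻¹) (hν : Integrable (fun q => (1 + ‖q‖) ^ N) ν)
    (r : Space n) :
    ∫ p, avg ν G p * θ (r - p) = ∫ p, G p * avg ν θ (r - p) := by
  rw [integral_mul_avg hG hGi hθ hB hν]
  have hk := integrable_convolution_kernel hG hGi hθ hB hν r
  have htr : ∀ q : Space n, (fun p => G (p + q) * θ (r - p)) =
      fun p => (fun p => G p * θ (r - p + q)) (p + q) := by
    intro q
    ext p
    congr 2
    abel
  -- For fixed q this is a translate in p of the previous kernel, so the fibre integrals agree.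
  have hi : Integrable (fun s : Space n × Space n => G (s.1 + s.2) * θ (r - s.1))
      (volume.prod ν) := by
    rw [integrable_prod_iff' (Continuous.aestronglyMeasurable (by fun_prop))]
    obtain ⟨h1, h2⟩ := (integrable_prod_iff' hk.aestronglyMeasurable).1 hk
    constructor
    · filter_upwards [h1] with q hq
      rw [htr]
      exact hq.comp_add_right q
    · refine h2.congr (.of_forall fun q => ?_)
      have h3 := integral_add_right_eq_self (μ := (volume : Measure (Space n)))
        (fun p => ‖G p * θ (r - p + q)‖) q
      simp only at h3 ⊢
      rw [← h3]
      refine integral_congr_ae (.of_forall fun p => ?_)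
      exact congrArg norm (congrFun (htr q) p).symm
  simp only [avg, ← integral_mul_const]
  rw [integral_integral_swap hi]
  refine integral_congr_ae (.of_forall fun q => ?_)
  simp only [htr]
  rw [integral_add_right_eq_self (fun p => G p * θ (r - p + q)) q]
  simp only [sub_add_eq_add_sub]

/-- The order N of decay is not lost, so averages can be iterated against the same G. -/
lemma norm_avg_le (hB : ∀ p, ‖θ p‖ ≤ B * ((1 + ‖p‖) ^ N)⁻¹)
    (hν : Integrable (fun q => (1 + ‖q‖) ^ N) ν) (p : Space n) :
    ‖avg ν θ p‖ ≤ (B * ∫ q, (1 + ‖q‖) ^ N ∂ν) * ((1 + ‖p‖) ^ N)⁻¹ := by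
  have hB0 : 0 ≤ B := by
    have := (norm_nonneg _).trans (hB 0)
    simpa using this
  have h := norm_integral_le_of_norm_le (μ := ν) (f := fun q => θ (p + q))
    (hν.const_mul (B * ((1 + ‖p‖) ^ N)⁻¹)) (.of_forall fun q => ?_)
  · rw [integral_const_mul] at h
    exact h.trans_eq (by ring)
  · have h1 := one_add_norm_pow_inv_le p (p + q) N
    have h2 : p - (p + q) = -q := by abel
    rw [h2, norm_neg] at h1
    calc _ ≤ B * ((1 + ‖p + q‖) ^ N)⁻¹ := hB _
      _ ≤ B * (((1 + ‖p‖) ^ N)⁻¹ * (1 + ‖q‖) ^ N) := by gcongr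
      _ = _ := by ring

lemma continuous_avg [IsFiniteMeasure ν] (hθ : Continuous θ)
    (hB : ∀ p, ‖θ p‖ ≤ B * ((1 + ‖p‖) ^ N)⁻¹) : Continuous (avg ν θ) := by
  have hB0 : 0 ≤ B := by
    have := (norm_nonneg _).trans (hB 0)
    simpa using this
  refine continuous_of_dominated (bound := fun _ => B)
    (fun p => Continuous.aestronglyMeasurable (by fun_prop))
    (fun p => .of_forall fun q => (hB _).trans ?_) (integrable_const B)
    (.of_forall fun q => by fun_prop)
  have : ((1 + ‖p + q‖) ^ N)⁻¹ ≤ 1 :=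
    inv_le_one_of_one_le₀ (one_le_pow₀ (by linarith [norm_nonneg (p + q)]))
  nlinarith

/-- A continuous tempered function annihilated by convolution with `θ` is annihilated by
convolution with all iterated averages of `θ`. -/
lemma integral_mul_avg_iterate_eq_zero [IsFiniteMeasure ν] (hG : Continuous G)
    (hGi : Integrable fun p => ((1 + ‖p‖) ^ N)⁻¹ • G p) (hθ : Continuous θ)
    (hB : ∀ p, ‖θ p‖ ≤ B * ((1 + ‖p‖) ^ N)⁻¹) (hν : Integrable (fun q => (1 + ‖q‖) ^ N) ν)
    (h0 : ∀ r, ∫ p, G p * θ (r - p) = 0) (j : ℕ) (r : Space n) :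
    ∫ p, G p * (avg ν)^[j] θ (r - p) = 0 := by
  induction j generalizing θ B r with
  | zero => exact h0 r
  | succ j ih =>
    rw [Function.iterate_succ_apply]
    refine ih (continuous_avg hθ hB) (norm_avg_le hB hν) (fun r => ?_) r
    rw [integral_mul_avg hG hGi hθ hB hν]
    simp [h0]

end Duality

/-! ### Injectivity of Lⁿ A on tempered functions. -/

section Uniqueness

variable {m : ℕ} {μ ψ : ℝ}

lemma exists_decay_of_hasCompactSupport {n : ℕ} {θ : Space n → ℂ} (hθ : Continuous θ)
    (hc : HasCompactSupport θ) (N : ℕ) : ∃ B, ∀ p, ‖θ p‖ ≤ B * ((1 + ‖p‖) ^ N)⁻¹ := by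
  obtain ⟨B, hB⟩ := (hc.smul_left (f := fun p => (1 + ‖p‖) ^ N)).exists_bound_of_continuous
    (by fun_prop)
  refine ⟨B, fun p => ?_⟩
  have := hB p
  rw [Pi.smul_apply', norm_smul, Real.norm_of_nonneg (by positivity)] at this
  rw [← div_eq_mul_inv, le_div_iff₀ (by positivity)]
  linarith

/-- A tempered function whose auxiliary transform is annihilated by `L ^ n` vanishes. -/
lemma eq_zero_of_opL_iterate_avg_eq_zero (ha : 0 < μ / Real.cos ψ) {G : Space (m + 2) → ℂ}
    (hG : Continuous G) (hT : IsTempered G)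
    (hA : ContDiff ℝ ∞ (avg (coneNu (m + 2) μ ψ m) G))
    (h0 : ∀ p, (opL μ ψ)^[m + 2] (avg (coneNu (m + 2) μ ψ m) G) p = 0) : G = 0 := by
  have := isFiniteMeasure_coneMeasure (n := m + 2) ha (Real.tan ψ) m
  obtain ⟨N, hN⟩ := hT
  have hν := integrable_moment_coneMeasure (n := m + 2) ha (Real.tan ψ) m N
  have key : ∀ φ : Space (m + 2) → ℂ, ContDiff ℝ ∞ φ → HasCompactSupport φ → ∀ r,
      ∫ p, G p * φ (r - p) = 0 := by
    intro φ hφ hc r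
    have hφ1 := contDiff_opL_iterate μ ψ hφ m
    have hc1 := hasCompactSupport_opL_iterate μ ψ hφ hc m
    have hφ2 := contDiff_opL_iterate μ ψ hφ1 (m + 2)
    have hc2 := hasCompactSupport_opL_iterate μ ψ hφ1 hc1 (m + 2)
    obtain ⟨B, hB⟩ := exists_decay_of_hasCompactSupport hφ2.continuous hc2 N
    -- Moving A and then Lⁿ back onto G produces the function that vanishes by `h0`.
    have hθ : ∀ r, ∫ p, G p * avg (coneNu (m + 2) μ ψ m)
        ((opL μ ψ)^[m + 2] ((opL μ ψ)^[m] φ)) (r - p) = 0 := by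
      intro r
      rw [← integral_avg_mul hG hN hφ2.continuous hB hν,
        ← integral_opL_iterate_mul hA hφ1 hc1]
      simp [h0]
    -- Three more averages give the four that recover φ up to a nonzero constant.
    have h3 := integral_mul_avg_iterate_eq_zero hG hN (continuous_avg hφ2.continuous hB)
      (norm_avg_le hB hν) hν hθ 3 r
    rw [← Function.iterate_succ_apply, avg_iterate_opL_iterate ha hφ hc] at h3
    simp only [mul_left_comm (G _), integral_const_mul] at h3
    exact (mul_eq_zero.1 h3).resolve_left (pow_ne_zero _ (symbolConst_ne_zero m))
  have hae := ae_eq_zero_of_integral_contDiff_smul_eq_zero (μ := (volume : Measure (Space (m + 2))))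
    hG.locallyIntegrable (fun g hg hgc => by
      have h1 := key (fun p => (g (-p) : ℂ))
        (Complex.ofRealCLM.contDiff.comp (hg.comp contDiff_neg))
        ((hgc.comp_homeomorph (Homeomorph.neg _)).comp_left Complex.ofReal_zero) 0
      simpa [mul_comm] using h1)
  exact (Continuous.ae_eq_iff_eq volume hG continuous_zero).1 hae

end Uniqueness

/-! ### The vertical equation ∂_z f = h + a f. -/

section Primitive

/-- The solution is f = e^{az} ∫_{-∞}^z e^{-au} h du, which vanishes below the support of h, and
above it by `h0`. Written as a convolution in z with 1_{s ≥ 0} e^{as}, it is jointly smooth in (x,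
z). -/
lemma exists_vertical_primitive {n : ℕ} (a : ℝ) {h : Space n → ℂ} (hh : ContDiff ℝ ∞ h)
    (hc : HasCompactSupport h) (h0 : ∀ x, ∫ z : ℝ, Real.exp (-a * z) • h (x, z) = 0) :
    ∃ f : Space n → ℂ, ContDiff ℝ ∞ f ∧ HasCompactSupport f ∧
      ∀ p, dirDeriv (vert n) f p = h p + a * f p := by
  obtain ⟨R, hR⟩ := hc.isCompact.isBounded.subset_closedBall (0 : Space n)
  have hzero : ∀ x z, R < ‖x‖ ∨ R < |z| → h (x, z) = 0 := by
    intro x z hxz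
    refine image_eq_zero_of_notMem_tsupport fun hm => ?_
    have h1 := hR hm
    rw [mem_closedBall_zero_iff, Prod.norm_def] at h1
    obtain ⟨h2, h3⟩ := max_le_iff.1 h1
    rcases hxz with hx | hz
    · exact absurd h2 (not_le.2 hx)
    · exact absurd h3 (not_le.2 hz)
  set φ : ℝ → ℝ := (Ici (0 : ℝ)).indicator fun s => Real.exp (a * s) with hφ
  set k : EuclideanSpace ℝ (Fin n) → ℝ → ℂ := fun x u => Real.exp (-a * u) • h (x, u) with hk
  have hkc : ∀ x, Continuous (k x) := fun x => by
    have := hh.continuous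
    fun_prop
  have hks : ∀ x, HasCompactSupport (k x) := fun x =>
    HasCompactSupport.intro (isCompact_closedBall (0 : ℝ) R) fun u hu => by
      have : R < |u| := by simpa using hu
      simp [hk, hzero x u (Or.inr this)]
  have hki : ∀ x, Integrable (k x) := fun x => (hkc x).integrable_of_hasCompactSupport (hks x)
  set f : Space n → ℂ := fun q => convolution φ (fun z => h (q.1, z)) (ContinuousLinearMap.lsmul ℝ ℝ)
    volume q.2 with hf
  have hfe : ∀ x z, f (x, z) = Real.exp (a * z) • ∫ u in Iic z, k x u := by
    intro x z
    rw [← integral_smul, ← integral_indicator measurableSet_Iic,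
      ← integral_sub_left_eq_self _ volume z]
    refine integral_congr_ae (.of_forall fun s => ?_)
    simp only [ContinuousLinearMap.lsmul_apply, hφ, hk, indicator, mem_Ici, mem_Iic, smul_smul,
      ← Real.exp_add]
    by_cases hs : 0 ≤ s
    · rw [if_pos hs, if_pos (by linarith)]
      congr 2
      ring
    · rw [if_neg hs, if_neg (by linarith), zero_smul]
  have hloc : LocallyIntegrable φ volume :=
    (Continuous.locallyIntegrable (by fun_prop)).indicator measurableSet_Ici
  have hsm : ContDiff ℝ ∞ f := by
    have h1 := contDiffOn_convolution_right_with_param (n := ⊤) (μ := (volume : Measure ℝ))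
      (ContinuousLinearMap.lsmul ℝ ℝ : ℝ →L[ℝ] ℂ →L[ℝ] ℂ)
      (g := fun (x : EuclideanSpace ℝ (Fin n)) z => h (x, z)) isOpen_univ
      (isCompact_closedBall (0 : ℝ) R)
      (fun x z _ hz => hzero x z (Or.inr (by simpa using hz))) hloc hh.contDiffOn
    rw [univ_prod_univ, contDiffOn_univ] at h1
    exact h1
  refine ⟨f, hsm, HasCompactSupport.intro (isCompact_closedBall (0 : Space n) R) ?_, ?_⟩
  · rintro ⟨x, z⟩ hp
    rw [hfe]
    have hp' : R < max ‖x‖ |z| := by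
      rw [mem_closedBall_zero_iff, not_le, Prod.norm_def] at hp
      exact hp
    have hint : ∫ u in Iic z, k x u = 0 := by
      rcases lt_max_iff.1 hp' with hx | hz
      · simp [hk, hzero x _ (Or.inl hx)]
      rcases lt_abs.1 hz with hz | hz
      -- Above the support the half-line integral is the full one, which is zero by `h0`.
      · rw [setIntegral_eq_integral_of_forall_compl_eq_zero]
        · exact h0 x
        · intro u hu
          have : z < u := by simpa using hu
          simp [hk, hzero x u (Or.inr (lt_abs.2 (Or.inl (hz.trans this))))]
      · rw [setIntegral_eq_zero_of_forall_eq_zero]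
        intro u hu
        have hu' : u ≤ z := hu
        simp [hk, hzero x u (Or.inr (lt_abs.2 (Or.inr (by linarith))))]
    rw [hint, smul_zero]
  · rintro ⟨x, z⟩
    have h1 := deriv_vertical (hsm.differentiable (by simp)) x z
    have h2 : HasDerivAt (fun z => ∫ u in Iic z, k x u) (k x z) z := by
      have h3 := intervalIntegral.integral_hasDerivAt_right (a := 0) (b := z)
        ((hkc x).intervalIntegrable 0 z) (hkc x).stronglyMeasurable.stronglyMeasurableAtFilter
        (hkc x).continuousAt
      refine (h3.add_const (∫ u in Iic 0, k x u)).congr_of_eventuallyEq (.of_forall fun y => ?_)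
      simp only
      rw [← intervalIntegral.integral_Iic_sub_Iic (hki x).integrableOn (hki x).integrableOn,
        sub_add_cancel]
    have h3 : HasDerivAt (fun z : ℝ => Real.exp (a * z)) (a * Real.exp (a * z)) z := by
      have := ((hasDerivAt_id z).const_mul a).exp
      convert! this using 1
      simp
      ring
    have h4 := h3.smul h2
    have h5 := h4.congr_of_eventuallyEq (f₁ := fun s => f (x, s)) (.of_forall fun y => hfe x y)
    rw [h1.unique h5, hfe]
    have he : ((Real.exp (a * z) : ℝ) : ℂ) * ((Real.exp (-a * z) : ℝ) : ℂ) = 1 := by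
      rw [← Complex.ofReal_mul, ← Real.exp_add]
      simp
    simp only [hk, Complex.real_smul, Complex.ofReal_mul a]
    linear_combination h (x, z) * he

/-- Vertical lines do not see the twisted vertical derivative of a test function. -/
lemma integral_exp_mul_dirDeriv_eq_zero {n : ℕ} (a : ℝ) {f : Space n → ℂ} (hf : ContDiff ℝ ∞ f)
    (hc : HasCompactSupport f) (x : EuclideanSpace ℝ (Fin n)) :
    ∫ z : ℝ, Real.exp (-a * z) • (a * f (x, z) - dirDeriv (vert n) f (x, z)) = 0 := by
  have hx : Topology.IsClosedEmbedding fun z : ℝ => ((x, z) : Space n) :=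
    Function.LeftInverse.isClosedEmbedding (f := Prod.snd) (fun _ => rfl) continuous_snd
      (by fun_prop)
  have hc1 : HasCompactSupport fun z => f (x, z) := hc.comp_isClosedEmbedding hx
  have hc2 : HasCompactSupport fun z => dirDeriv (vert n) f (x, z) :=
    (hasCompactSupport_dirDeriv hc _).comp_isClosedEmbedding hx
  have hf1 := hf.continuous
  have hf2 := (contDiff_dirDeriv hf (vert n)).continuous
  have h0 : Integrable fun z : ℝ => Real.exp (-a * z) • f (x, z) :=
    Continuous.integrable_of_hasCompactSupport (by fun_prop)
      (hc1.smul_left (f := fun z : ℝ => Real.exp (-a * z)))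
  have h1 : Integrable fun z : ℝ => -(Real.exp (-a * z) • f (x, z)) := h0.neg
  have hc3 : HasCompactSupport fun z => a * f (x, z) - dirDeriv (vert n) f (x, z) :=
    HasCompactSupport.sub (hc1.mul_left (f := fun _ : ℝ => (a : ℂ))) hc2
  have h2 : Integrable fun z : ℝ =>
      Real.exp (-a * z) • (a * f (x, z) - dirDeriv (vert n) f (x, z)) :=
    Continuous.integrable_of_hasCompactSupport (by fun_prop)
      (hc3.smul_left (f := fun z : ℝ => Real.exp (-a * z)))
  -- The integrand is the derivative of -e^{-az} f.
  refine integral_eq_zero_of_hasDerivAt_of_integrable (fun z => ?_) h2 h1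
  have h3 := deriv_vertical (hf.differentiable (by simp)) x z
  have h4 : HasDerivAt (fun z : ℝ => Real.exp (-a * z)) (-a * Real.exp (-a * z)) z := by
    have := ((hasDerivAt_id z).const_mul (-a)).exp
    convert! this using 1
    simp
    ring
  refine (h4.smul h3).neg.congr_deriv ?_
  simp only [Complex.real_smul]
  push_cast
  ring

end Primitive

/-! ### The range theorem. -/

section Range

variable {m : ℕ} {μ ψ : ℝ}

lemma IsTempered.sub {n : ℕ} {g₁ g₂ : Space n → ℂ} (hg₁ : Continuous g₁) (hg₂ : Continuous g₂)
    (h₁ : IsTempered g₁) (h₂ : IsTempered g₂) : IsTempered fun p => g₁ p - g₂ p := by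
  have mono : ∀ {g : Space n → ℂ}, Continuous g → ∀ {N M : ℕ}, N ≤ M →
      Integrable (fun p => ((1 + ‖p‖) ^ N)⁻¹ • g p) →
      Integrable (fun p => ((1 + ‖p‖) ^ M)⁻¹ • g p) := by
    intro g hg N M hNM h
    refine h.mono (Continuous.aestronglyMeasurable ?_) (.of_forall fun p => ?_)
    · refine Continuous.smul (f := fun p => ((1 + ‖p‖) ^ M)⁻¹)
        (Continuous.inv₀ (by fun_prop) fun p => ?_) hg
      positivity
    · rw [norm_smul, norm_smul, Real.norm_of_nonneg (by positivity),
        Real.norm_of_nonneg (by positivity)]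
      gcongr
      linarith [norm_nonneg p]
  obtain ⟨N, hN⟩ := h₁
  obtain ⟨M, hM⟩ := h₂
  refine ⟨max N M, ?_⟩
  simp only [smul_sub]
  exact (mono hg₁ (le_max_left N M) hN).sub (mono hg₂ (le_max_right N M) hM)

/-- The constant in the reconstruction formula. -/
def reconstructionConst (m : ℕ) (ψ : ℝ) : ℂ := normConst m ψ ^ 2 * ((m + 1) * symbolConst m)

lemma normConst_ne_zero (m : ℕ) (hψ : ψ ∈ Ioo 0 (Real.pi / 2)) : normConst m ψ ≠ 0 := by
  have h1 := Real.tan_pos_of_pos_of_lt_pi_div_two hψ.1 hψ.2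
  have h2 := Real.cos_pos_of_mem_Ioo ⟨by linarith [hψ.1, Real.pi_pos], hψ.2⟩
  rw [normConst, Complex.ofReal_ne_zero]
  positivity

lemma reconstructionConst_ne_zero (m : ℕ) (hψ : ψ ∈ Ioo 0 (Real.pi / 2)) :
    reconstructionConst m ψ ≠ 0 :=
  mul_ne_zero (pow_ne_zero _ (normConst_ne_zero m hψ))
    (mul_ne_zero (by norm_cast) (symbolConst_ne_zero m))

/-- Properties of the conical Radon transform of a test function. -/
lemma coneTransform_testFunction (ha : 0 < μ / Real.cos ψ) {f : Space (m + 2) → ℂ}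
    (hf : ContDiff ℝ ∞ f) (hc : HasCompactSupport f) :
    ContDiff ℝ ∞ (coneTransform μ ψ f) ∧ IsTempered (coneTransform μ ψ f) ∧
    AuxConverges μ ψ (coneTransform μ ψ f) ∧
    ContDiff ℝ ∞ (auxTransform μ ψ (coneTransform μ ψ f)) ∧
    (opL μ ψ)^[m + 2] (auxTransform μ ψ (coneTransform μ ψ f)) = fun p =>
      reconstructionConst m ψ * ((μ / Real.cos ψ : ℝ) * f p - dirDeriv (vert (m + 2)) f p) := by
  have := isFiniteMeasure_coneMeasure (n := m + 2) ha (Real.tan ψ) m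
  have := isFiniteMeasure_coneMeasure (n := m + 2) ha (Real.tan ψ) (m + 1)
  obtain ⟨B₀, hB₀⟩ := hc.exists_bound_of_continuous hf.continuous
  obtain ⟨h1, h2, B, hB⟩ := contDiff_avg_coneMeasure ha m (m + 1) hf hc
  have e := coneTransform_eq (μ := μ) (ψ := ψ) hf.continuous
    (fun p => integrable_avg hf.continuous hB₀ p)
  have hs : ContDiff ℝ ∞ (coneTransform μ ψ f) := by
    rw [e]
    exact contDiff_const.mul h1
  have hb : ∀ p, ‖coneTransform μ ψ f p‖ ≤ ‖normConst m ψ‖ * B := fun p => by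
    rw [e, norm_mul]
    exact mul_le_mul_of_nonneg_left (hB p) (norm_nonneg _)
  have haux : AuxConverges μ ψ (coneTransform μ ψ f) :=
    (auxConverges_iff hs.continuous).2 fun p => integrable_avg hs.continuous hb p
  have e2 : auxTransform μ ψ (coneTransform μ ψ f) = fun p => normConst m ψ ^ 2 *
      avg (coneNu (m + 2) μ ψ m) (avg (coneNu (m + 2) μ ψ (m + 1)) f) p := by
    rw [auxTransform_eq hs.continuous haux]
    ext p
    rw [avg, e, integral_const_mul, pow_two, mul_assoc]
    rfl
  refine ⟨hs, isTempered_of_bounded hs.continuous hb, haux, ?_, ?_⟩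
  · rw [e2]
    exact contDiff_const.mul h2
  · rw [e2, opL_iterate_const_mul h2, opL_iterate_avg_avg ha hf hc, reconstructionConst]
    ext p
    ring

/-- A tempered function in the kernel of `L ^ n A` vanishes. -/
lemma eq_of_opL_iterate_auxTransform_eq (hμ : 0 < μ / Real.cos ψ) (hψ : ψ ∈ Ioo 0 (Real.pi / 2))
    {g₁ g₂ : Space (m + 2) → ℂ} (hg₁ : Continuous g₁) (hg₂ : Continuous g₂)
    (ht₁ : IsTempered g₁) (ht₂ : IsTempered g₂)
    (ha₁ : AuxConverges μ ψ g₁) (ha₂ : AuxConverges μ ψ g₂)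
    (hs₁ : ContDiff ℝ ∞ (auxTransform μ ψ g₁)) (hs₂ : ContDiff ℝ ∞ (auxTransform μ ψ g₂))
    (h : (opL μ ψ)^[m + 2] (auxTransform μ ψ g₁) = (opL μ ψ)^[m + 2] (auxTransform μ ψ g₂)) :
    g₁ = g₂ := by
  have hn := normConst_ne_zero m hψ
  have e : avg (coneNu (m + 2) μ ψ m) (fun p => g₁ p - g₂ p) = fun p =>
      (normConst m ψ)⁻¹ * (auxTransform μ ψ g₁ p - auxTransform μ ψ g₂ p) := by
    ext p
    rw [avg, integral_sub ((auxConverges_iff hg₁).1 ha₁ p) ((auxConverges_iff hg₂).1 ha₂ p),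
      auxTransform_eq hg₁ ha₁, auxTransform_eq hg₂ ha₂]
    simp only [avg]
    field_simp
  have hG := eq_zero_of_opL_iterate_avg_eq_zero (G := fun p => g₁ p - g₂ p) hμ
    (hg₁.sub hg₂) (ht₁.sub hg₁ hg₂ ht₂)
    (by
      rw [e]
      exact contDiff_const.mul (hs₁.sub hs₂))
    (fun p => by
      rw [e, opL_iterate_const_mul (hs₁.sub hs₂), opL_iterate_sub hs₁ hs₂, h]
      simp)
  ext p
  exact sub_eq_zero.1 (congrFun hG p)

/-- The range of the conical Radon transform on test functions. -/
lemma mem_range_iff (hμ : 0 < μ / Real.cos ψ) (hψ : ψ ∈ Ioo 0 (Real.pi / 2))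
    {g : Space (m + 2) → ℂ} (hg : ContDiff ℝ ∞ g) (ht : IsTempered g) :
    g ∈ coneTransform μ ψ '' testFunctions (m + 2) ↔
      (AuxConverges μ ψ g ∧ ContDiff ℝ ∞ (auxTransform μ ψ g)) ∧
      HasCompactSupport ((opL μ ψ)^[m + 2] (auxTransform μ ψ g)) ∧
      ∀ x : EuclideanSpace ℝ (Fin (m + 2)), ∫ z : ℝ, Real.exp (-(μ / Real.cos ψ) * z) •
        ((opL μ ψ)^[m + 2] (auxTransform μ ψ g)) (x, z) = 0 := by
  constructor
  · rintro ⟨f, ⟨hf, hc⟩, rfl⟩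
    obtain ⟨-, -, h1, h2, h3⟩ := coneTransform_testFunction hμ hf hc
    refine ⟨⟨h1, h2⟩, ?_, fun x => ?_⟩
    · rw [h3]
      exact HasCompactSupport.mul_left (f := fun _ => reconstructionConst m ψ)
        (HasCompactSupport.sub (hc.mul_left (f := fun _ => ((μ / Real.cos ψ : ℝ) : ℂ)))
          (hasCompactSupport_dirDeriv hc _))
    · have h4 := integral_exp_mul_dirDeriv_eq_zero (μ / Real.cos ψ) hf hc x
      rw [h3]
      simp only [← mul_smul_comm _ (reconstructionConst m ψ)]
      rw [integral_const_mul, h4, mul_zero]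
  · rintro ⟨⟨h1, h2⟩, h3, h4⟩
    have hr := reconstructionConst_ne_zero m hψ
    -- The factor -(const)⁻¹ makes ∂_z f = h + a f the same as const · (a f - ∂_z f) = Lⁿ A g.
    obtain ⟨f, hf, hc, hd⟩ := exists_vertical_primitive (μ / Real.cos ψ)
      (h := fun p => -(reconstructionConst m ψ)⁻¹ * (opL μ ψ)^[m + 2] (auxTransform μ ψ g) p)
      (contDiff_const.mul (contDiff_opL_iterate μ ψ h2 (m + 2))) h3.mul_left (fun x => by
        simp only [← mul_smul_comm _ (-(reconstructionConst m ψ)⁻¹)]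
        rw [integral_const_mul, h4, mul_zero])
    obtain ⟨k1, k2, k3, k4, k5⟩ := coneTransform_testFunction hμ hf hc
    refine ⟨f, ⟨hf, hc⟩, ?_⟩
    -- C f is bounded, hence tempered, so injectivity applies to C f and g.
    refine eq_of_opL_iterate_auxTransform_eq hμ hψ k1.continuous hg.continuous k2 ht k3 h1 k4 h2 ?_
    rw [k5]
    ext p
    rw [hd]
    field_simp
    ring

end Range

end ConicalRadon
end

theorem theorem2 (k : ℕ) (hk : 1 ≤ k) (μ ψ : ℝ) (hμ : 0 < μ) (hψ : ψ ∈ Set.Ioo 0 (Real.pi / 2))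
    (g : ConicalRadon.Space (2 * k) → ℂ) (hg : ContDiff ℝ ∞ g) :
    (g ∈ ConicalRadon.coneTransform μ ψ '' ConicalRadon.testFunctions (2 * k) →
      ConicalRadon.IsTempered g) ∧
    (ConicalRadon.IsTempered g →
      (g ∈ ConicalRadon.coneTransform μ ψ '' ConicalRadon.testFunctions (2 * k) ↔
        (ConicalRadon.AuxConverges μ ψ g ∧ ContDiff ℝ ∞ (ConicalRadon.auxTransform μ ψ g)) ∧
        HasCompactSupport ((ConicalRadon.opL μ ψ)^[2 * k] (ConicalRadon.auxTransform μ ψ g)) ∧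
        ∀ x : EuclideanSpace ℝ (Fin (2 * k)),
          ∫ z : ℝ, Real.exp (-(μ / Real.cos ψ) * z) •
            ((ConicalRadon.opL μ ψ)^[2 * k] (ConicalRadon.auxTransform μ ψ g)) (x, z) = 0)) := by
  have hcos := Real.cos_pos_of_mem_Ioo ⟨by linarith [hψ.1, Real.pi_pos], hψ.2⟩
  have ha : 0 < μ / Real.cos ψ := div_pos hμ hcos
  -- With dimension m + 2 the truncated exponents n - 2 and n - 1 reduce to m and m + 1.
  obtain ⟨m, hm⟩ : ∃ m, 2 * k = m + 2 := ⟨2 * k - 2, by omega⟩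
  generalize 2 * k = n at *
  subst hm
  refine ⟨?_, fun ht => ConicalRadon.mem_range_iff ha hψ hg ht⟩
  rintro ⟨f, ⟨hf, hc⟩, rfl⟩
  exact (ConicalRadon.coneTransform_testFunction ha hf hc).2.1
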